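/- **Proposition (asymptotic local self-similarity).** Let $(N,h)$ be any smooth $m$-dimensional Riemannian manifold without boundary, with Levi-Civita connection $\nabla$, and equip $\mathbf{R}^{1+2}$, with coordinates $(x^0,x^1,x^2)=(t,x)$, with the Minkowski metric $-dt^2+dx^2$, used to raise and lower indices. Let $\psi=(\psi_0,\psi_1,\psi_2)$, $\psi_\alpha:[-1,0)\times\mathbf{R}^2\to\mathbf{R}^m$, be a Schwartz derivative wave map on $[-1,0)\times\mathbf{R}^2$ with target $N$. That is, there are * a smooth map $\phi:[-1,0)\times\mathbf{R}^2\to N$ and a point $\phi(\infty)\in N$ such that for each fixed $t$, as $|x|\to\infty$, $\phi(t,x)$ converges to $\phi(\infty)$ faster than any negative power of $|x|$, and all spacetime derivatives of $\phi$ converge to zero faster than any negative power of $|x|$ (in local coordinates near $\phi(\infty)$), * a smooth orthonormal frame $e(t,x):\mathbf{R}^m\to T_{\phi(t,x)}N$ of $\phi^*(TN)$, and * $m\times m$ matrix-valued functions $A_\alpha$ on $[-1,0)\times\mathbf{R}^2$, such that on $[-1,0)\times\mathbf{R}^2$, for $\alpha=0,1,2$, $$\partial_\alpha\phi=e\,\psi_\alpha,\qquad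 (\phi^*\nabla)_\alpha e=e\,A_\alpha,\qquad D^\alpha\psi_\alpha=0,\quad\text{where } D_\alpha:=\partial_\alpha+A_\alpha.$$ (Equivalently, $\phi$ is a Schwartz wave map and $\psi_\alpha=e^{-1}\partial_\alpha\phi$. No symmetry is assumed.) Let $\psi_S:=x^\alpha\psi_\alpha=t\psi_0+x_1\psi_1+x_2\psi_2$ be the component of $\psi$ along the scaling field $S=x^\alpha\partial_\alpha$, so that $\frac1t\psi_S=\psi_0+\frac{x_j}{t}\psi_j$. Then for every $-1<T<0$ the function $\frac1t\left|\frac1t\psi_S(t,x)\right|^2$ is integrable on the truncated cone $\{-1\le t\le T,\ |x|<|t|\}$, and $$\lim_{T\to0^-}\frac{1}{|\log|T||}\int_{-1}^{T}\int_{|x|<|t|}\Big|\frac1t\psi_S(t,x)\Big|^2\,dx\,\frac{dt}{t}=0.$$ -/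

import Mathlib

open Set Filter Topology MeasureTheory
open scoped Manifold ContDiff

noncomputable section

namespace WaveMap

/-- `ℝ^m` with its Euclidean inner product. -/
abbrev Euc (m : ℕ) : Type := EuclideanSpace ℝ (Fin m)

/-- The spacetime `ℝ^{1+2}` with coordinates `(t, x)`. -/
abbrev Spacetime : Type := ℝ × Euc 2

/-- The slab `[-1, 0) × ℝ²`. -/
def slab : Set Spacetime := Ico (-1 : ℝ) 0 ×ˢ univ

/-- The coordinate vectors `∂_0 = ∂_t`, `∂_1`, `∂_2` of spacetime. -/
def coordVec : Fin 3 → Spacetime :=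
  ![(1, 0), (0, EuclideanSpace.single 0 1), (0, EuclideanSpace.single 1 1)]

/-- The diagonal entries of the Minkowski metric `-dt² + dx²` (it is its own inverse). -/
def minkowski : Fin 3 → ℝ := ![-1, 1, 1]

/-- The partial derivative `∂_α f` of a vector-valued function on the slab
(one-sided in time at `t = -1`). -/
def pderiv {F : Type*} [NormedAddCommGroup F] [NormedSpace ℝ F]
    (α : Fin 3) (f : Spacetime → F) (p : Spacetime) : F :=
  fderivWithin ℝ f slab p (coordVec α)

section Target

variable {m : ℕ} {N : Type*} [TopologicalSpace N] [ChartedSpace (Euc m) N]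

/-- Smooth Riemannian metrics on the `m`-dimensional manifold `N`. -/
abbrev RiemMetric (m : ℕ) (N : Type*) [TopologicalSpace N] [ChartedSpace (Euc m) N]
    [IsManifold (𝓡 m) ∞ N] : Type _ :=
  Bundle.ContMDiffRiemannianMetric (𝓡 m) ∞ (Euc m) (fun x : N => TangentSpace (𝓡 m) x)

/-- The partial derivative `∂_α φ`, a vector field along `φ`. -/
def mapDeriv (φ : Spacetime → N) (α : Fin 3) (p : Spacetime) : TangentSpace (𝓡 m) (φ p) :=
  mfderivWithin 𝓘(ℝ, Spacetime) (𝓡 m) φ slab p (coordVec α)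

/-- The tangent vector at `y` with components `v` in the coordinates given by the chart at `q`. -/
def ofCoord (q : N) (y : Euc m) (v : Euc m) :
    TangentSpace (𝓡 m) ((extChartAt (𝓡 m) q).symm y) :=
  mfderiv 𝓘(ℝ, Euc m) (𝓡 m) (extChartAt (𝓡 m) q).symm y v

/-- The components, in the coordinates given by the chart at `q`, of a tangent vector at `z`. -/
def toCoord (q z : N) (v : TangentSpace (𝓡 m) z) : Euc m :=
  mfderiv (𝓡 m) 𝓘(ℝ, Euc m) (extChartAt (𝓡 m) q) z v

variable [IsManifold (𝓡 m) ∞ N]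

/-- The matrix `h_{ab}` of the metric in the coordinates given by the chart at `q`. -/
def gram (h : RiemMetric m N) (q : N) (y : Euc m) : Matrix (Fin m) (Fin m) ℝ :=
  Matrix.of fun a b => h.inner ((extChartAt (𝓡 m) q).symm y)
    (ofCoord q y (EuclideanSpace.single a 1)) (ofCoord q y (EuclideanSpace.single b 1))

/-- The Christoffel symbols
`Γ^a_{bc} = ½ h^{ad} (∂_b h_{dc} + ∂_c h_{db} - ∂_d h_{bc})` of the Levi-Civita connection
in the coordinates given by the chart at `q`. -/
def christoffel (h : RiemMetric m N) (q : N) (y : Euc m) (a b c : Fin m) : ℝ :=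
  (1 / 2) * ∑ d, (gram h q y)⁻¹ a d *
    (fderiv ℝ (fun z => gram h q z d c) y (EuclideanSpace.single b 1)
      + fderiv ℝ (fun z => gram h q z d b) y (EuclideanSpace.single c 1)
      - fderiv ℝ (fun z => gram h q z b c) y (EuclideanSpace.single d 1))

/-- The pull-back Levi-Civita derivative `(φ^*∇)_α V` of a vector field `V` along `φ`. At `p` it is
computed in the chart `(φ^a)` at `φ p`, where its components are
`∂_α V^a + Γ^a_{bc}(φ) ∂_α φ^b V^c`. Mathlib's `TangentSpace (𝓡 m) q` is by definition the space of
components in the chart at `q`, so these components are the tangent vector itself. -/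
def covDeriv (h : RiemMetric m N) (φ : Spacetime → N)
    (V : ∀ p, TangentSpace (𝓡 m) (φ p)) (α : Fin 3) (p : Spacetime) :
    TangentSpace (𝓡 m) (φ p) :=
  (WithLp.toLp 2 fun a : Fin m =>
    pderiv α (fun p' => toCoord (φ p) (φ p') (V p') a) p
      + ∑ b, ∑ c, christoffel h (φ p) (extChartAt (𝓡 m) (φ p) (φ p)) a b c
          * pderiv α (fun p' => extChartAt (𝓡 m) (φ p) (φ p') b) p
          * toCoord (φ p) (φ p) (V p) c : Euc m)

/-- `φ` is smooth on the slab and, at each time, decays at spatial infinity to a point `φ(∞)`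
faster than any power of `|x|`, together with all its (spacetime) derivatives; since `φ(t, x)`
lies near `φ(∞)` for large `x`, this is expressed in the chart at `φ(∞)`. -/
structure IsSchwartzMap (φ : Spacetime → N) : Prop where
  smooth : ContMDiffOn 𝓘(ℝ, Spacetime) (𝓡 m) ∞ φ slab
  decay : ∃ φinf : N, ∀ t ∈ Ico (-1 : ℝ) 0,
    Tendsto (fun x : Euc 2 => φ (t, x)) (cocompact (Euc 2)) (𝓝 φinf) ∧
    ∀ n k : ℕ, Tendsto (fun x : Euc 2 => ‖x‖ ^ k *
      ‖iteratedFDerivWithin ℝ n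
        (fun p => extChartAt (𝓡 m) φinf (φ p) - extChartAt (𝓡 m) φinf φinf) slab (t, x)‖)
      (cocompact (Euc 2)) (𝓝 0)

/-- `e = (e_1, …, e_m)` is a smooth orthonormal frame of `φ^*(TN)` over the slab. -/
structure IsOrthonormalFrame (h : RiemMetric m N) (φ : Spacetime → N)
    (e : Fin m → ∀ p, TangentSpace (𝓡 m) (φ p)) : Prop where
  smooth : ∀ i, ContMDiffOn 𝓘(ℝ, Spacetime) (𝓡 m).tangent ∞
    (fun p => (⟨φ p, e i p⟩ : TangentBundle (𝓡 m) N)) slab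
  orthonormal : ∀ p ∈ slab, ∀ i j, h.inner (φ p) (e i p) (e j p) = if i = j then 1 else 0

/-- The covariant derivative `D_α f = ∂_α f + A_α f` of an `ℝ^m`-valued function. -/
def gaugeDeriv (A : Fin 3 → Spacetime → Matrix (Fin m) (Fin m) ℝ) (α : Fin 3)
    (f : Spacetime → Euc m) (p : Spacetime) : Euc m :=
  pderiv α f p + WithLp.toLp 2 ((A α p).mulVec (f p))

/-- `ψ` is a Schwartz derivative wave map on `[-1, 0) × ℝ²` with target `(N, h)`: there are a
Schwartz map `φ` into `N`, a smooth orthonormal frame `e` along it, and connection coefficients `A`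
with `∂_α φ = e ψ_α`, `(φ^*∇)_α e = e A_α` and `D^α ψ_α = 0`. (The skew-symmetry of `A`, the zero
torsion identity and the curvature identity are consequences of the first two equations.) -/
def IsSchwartzDerivativeWaveMap (h : RiemMetric m N) (ψ : Fin 3 → Spacetime → Euc m) : Prop :=
  ∃ (φ : Spacetime → N) (e : Fin m → ∀ p, TangentSpace (𝓡 m) (φ p))
    (A : Fin 3 → Spacetime → Matrix (Fin m) (Fin m) ℝ),
    IsSchwartzMap (m := m) φ ∧ IsOrthonormalFrame h φ e ∧
    (∀ p ∈ slab, ∀ α, mapDeriv φ α p = ∑ i, ψ α p i • e i p) ∧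
    (∀ p ∈ slab, ∀ α i, covDeriv h φ (e i) α p = ∑ j, A α p j i • e j p) ∧
    (∀ p ∈ slab, ∑ α, minkowski α • gaugeDeriv A α (ψ α) p = 0)

end Target

/-- The component `ψ_S = S^α ψ_α = t ψ_0 + x_j ψ_j` along the scaling field `S = x^α ∂_α`. -/
def scalingComponent {m : ℕ} (ψ : Fin 3 → Spacetime → Euc m) (p : Spacetime) : Euc m :=
  p.1 • ψ 0 p + p.2 0 • ψ 1 p + p.2 1 • ψ 2 p

end WaveMap

end

noncomputable section

namespace WaveMap

/-! The proof is a vector field argument with a regularized scaling multiplier. Orthonormality of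
the frame makes the connection matrices skew (`connection_skew`) and the Levi-Civita connection has
no torsion (`gaugeDeriv_comm`). Together with the wave equation these make the stress-energy tensor
`T` divergence free (`divergence_stress`). The target geometry is not used beyond this point, and
its curvature never enters.

Contract `T` with `w S`, where `w = ((1 + δ²) t² - |x|²)^{-1/2}`. In dimension 1+2 the trace of `T`
cancels the Lagrangian terms produced by the gradient of `w`, and the divergence is exactly `w³
(|ψ_S|² + δ² t ⟨ψ_0, ψ_S⟩)` (`divergence_current`). The parameter `δ > 0` keeps `w` finite up to the
light cone, where `|t| w ≤ 1/δ`. For `t < 0` the field `S` points to the past, so a multiple `C ∂_t`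
with `C = 2/δ` is added. The dominant energy condition then gives the right sign to the flux through
the cone and to the term at the final time, and the divergence integrates to at most `(2/δ) E`, with
`E` the initial energy in the cone (`integral_cutoff_production_le_coneEnergy`). A smooth cutoff
replaces the boundary of the cone.

Pointwise in the cone, `|ψ_S / t|² / |t|` is at most 16 times the divergence plus `δ T_00 / |t|`
(`norm_sq_scaling_div_le`). The energy in the cone stays below `E`, so the last term contributes `δ
E |log|T||`. Altogether the integral is bounded by `16 E (2/δ + δ |log|T||)`. The choice `δ =
|log|T||^{-1/2}` makes this `48 E |log|T||^{1/2}`, which is `o(|log|T||)`. -/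

lemma uniqueDiffOn_slab : UniqueDiffOn ℝ slab :=
  (uniqueDiffOn_Ico _ _).prod uniqueDiffOn_univ

lemma slab_mem_nhds {p : Spacetime} (h₁ : -1 < p.1) (h₂ : p.1 < 0) : slab ∈ 𝓝 p :=
  mem_of_superset (((isOpen_Ioo (a := (-1 : ℝ)) (b := 0)).prod isOpen_univ).mem_nhds
    ⟨⟨h₁, h₂⟩, mem_univ _⟩) (prod_mono Ioo_subset_Ico_self subset_rfl)

/-! ### Tangent vectors, metric and smooth fields in charts -/

section Target

variable {m : ℕ} {N : Type*} [TopologicalSpace N] [ChartedSpace (Euc m) N]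
  [IsManifold (𝓡 m) ∞ N]

/-- The metric pairing of two smooth vector fields along a map is smooth. -/
lemma contDiffOn_metric {E' : Type*} [NormedAddCommGroup E'] [NormedSpace ℝ E']
    (h : RiemMetric m N) {f : E' → N} {V W : ∀ p, TangentSpace (𝓡 m) (f p)} {s : Set E'}
    (hV : ContMDiffOn 𝓘(ℝ, E') (𝓡 m).tangent ∞ (fun p => (⟨f p, V p⟩ : TangentBundle (𝓡 m) N)) s)
    (hW : ContMDiffOn 𝓘(ℝ, E') (𝓡 m).tangent ∞ (fun p => (⟨f p, W p⟩ : TangentBundle (𝓡 m) N)) s) :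
    ContDiffOn ℝ ∞ (fun p => h.inner (f p) (V p) (W p)) s := by
  intro x hx
  have hV' := hV x hx
  have hW' := hW x hx
  have hb : ContMDiffWithinAt 𝓘(ℝ, E') (𝓡 m) ∞ f s x :=
    (Bundle.contMDiffWithinAt_totalSpace.1 hV').1
  have : ContMDiffWithinAt 𝓘(ℝ, E') ((𝓡 m).prod 𝓘(ℝ)) ∞
      (fun p => Bundle.TotalSpace.mk' ℝ (E := Bundle.Trivial N ℝ) (f p)
        (h.inner (f p) (V p) (W p))) s x := by
    apply ContMDiffWithinAt.clm_bundle_apply₂ (F₁ := Euc m) (F₂ := Euc m)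
    · exact ContMDiffAt.comp_contMDiffWithinAt x h.contMDiff.contMDiffAt hb
    · exact hV'
    · exact hW'
  exact contMDiffWithinAt_iff_contDiffWithinAt.1 (Bundle.contMDiffWithinAt_totalSpace.1 this).2

/-- The partial derivatives of a smooth map are smooth vector fields along it. -/
lemma contMDiffOn_mapDeriv {φ : Spacetime → N}
    (hφ : ContMDiffOn 𝓘(ℝ, Spacetime) (𝓡 m) ∞ φ slab) (α : Fin 3) :
    ContMDiffOn 𝓘(ℝ, Spacetime) (𝓡 m).tangent ∞
      (fun p => (⟨φ p, mapDeriv φ α p⟩ : TangentBundle (𝓡 m) N)) slab := by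
  have h1 := hφ.contMDiffOn_tangentMapWithin (m := ∞) (by simp) uniqueDiffOn_slab.uniqueMDiffOn
  have h2 : ContMDiff 𝓘(ℝ, Spacetime) 𝓘(ℝ, Spacetime).tangent ∞
      (fun p => (⟨p, coordVec α⟩ : TangentBundle 𝓘(ℝ, Spacetime) Spacetime)) := by
    intro p
    exact contMDiffAt_vectorSpace_iff_contDiffAt.2 contDiffAt_const
  exact h1.comp h2.contMDiffOn (fun p hp => hp)

lemma contMDiffOn_ofCoord (q : N) (v : Euc m) :
    ContMDiffOn 𝓘(ℝ, Euc m) (𝓡 m).tangent ∞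
      (fun y => (⟨(extChartAt (𝓡 m) q).symm y, ofCoord q y v⟩ : TangentBundle (𝓡 m) N))
      (extChartAt (𝓡 m) q).target := by
  have ho : IsOpen (extChartAt (𝓡 m) q).target := isOpen_extChartAt_target q
  have h1 := (contMDiffOn_extChartAt_symm (I := 𝓡 m) (n := ∞) q).contMDiffOn_tangentMapWithin
    (m := ∞) (by simp) ho.uniqueDiffOn.uniqueMDiffOn
  have h2 : ContMDiff 𝓘(ℝ, Euc m) 𝓘(ℝ, Euc m).tangent ∞
      (fun p => (⟨p, v⟩ : TangentBundle 𝓘(ℝ, Euc m) (Euc m))) := by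
    intro p
    exact contMDiffAt_vectorSpace_iff_contDiffAt.2 contDiffAt_const
  refine (h1.comp h2.contMDiffOn (fun p hp => hp)).congr fun y hy => ?_
  simp only [Function.comp, tangentMapWithin, ofCoord]
  rw [mfderivWithin_of_isOpen ho hy]

lemma contDiffOn_gram (h : RiemMetric m N) (q : N) (a b : Fin m) :
    ContDiffOn ℝ ∞ (fun y => gram h q y a b) (extChartAt (𝓡 m) q).target :=
  contDiffOn_metric h (contMDiffOn_ofCoord q _) (contMDiffOn_ofCoord q _)

lemma gram_symm (h : RiemMetric m N) (q : N) (y : Euc m) (a b : Fin m) :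
    gram h q y a b = gram h q y b a := h.symm _ _ _

lemma ofCoord_toCoord (q : N) {y : Euc m} (hy : y ∈ (extChartAt (𝓡 m) q).target)
    (v : TangentSpace (𝓡 m) ((extChartAt (𝓡 m) q).symm y)) :
    ofCoord q y (toCoord q _ v) = v := by
  have := mfderivWithin_extChartAt_symm_comp_mfderiv_extChartAt (I := 𝓡 m) hy
  rw [ModelWithCorners.range_eq_univ, mfderivWithin_univ] at this
  exact DFunLike.congr_fun this v

lemma toCoord_ofCoord (q : N) {y : Euc m} (hy : y ∈ (extChartAt (𝓡 m) q).target) (v : Euc m) :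
    toCoord q _ (ofCoord q y v) = v := by
  have := mfderiv_extChartAt_comp_mfderivWithin_extChartAt_symm (I := 𝓡 m) hy
  rw [ModelWithCorners.range_eq_univ, mfderivWithin_univ] at this
  exact DFunLike.congr_fun this v

lemma toCoord_self (q : N) (v : TangentSpace (𝓡 m) q) : toCoord q q v = v :=
  DFunLike.congr_fun (mfderiv_extChartAt_self (I := 𝓡 m) (x := q)) v

lemma toCoord_sum_smul (q z : N) {ι : Type*} (s : Finset ι) (c : ι → ℝ)
    (v : ι → TangentSpace (𝓡 m) z) :
    toCoord q z (∑ i ∈ s, c i • v i) = ∑ i ∈ s, c i • toCoord q z (v i) := by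
  simp only [toCoord]
  rw [map_sum]
  refine Finset.sum_congr rfl fun i _ => ?_
  exact map_smul (mfderiv (𝓡 m) 𝓘(ℝ, Euc m) (extChartAt (𝓡 m) q) z) (c i) (v i)

lemma ofCoord_eq_sum (q : N) (y v : Euc m) :
    ofCoord q y v = ∑ a, v a • ofCoord q y (EuclideanSpace.single a 1) := by
  have hv : v = ∑ a, v a • EuclideanSpace.single a (1 : ℝ) := by
    ext b; simp [Finset.sum_apply, Pi.single_apply]
  conv_lhs => rw [hv]
  refine (map_sum (mfderiv 𝓘(ℝ, Euc m) (𝓡 m) (extChartAt (𝓡 m) q).symm y)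
    (fun a => v a • EuclideanSpace.single a (1 : ℝ)) Finset.univ).trans ?_
  refine Finset.sum_congr rfl fun i _ => ?_
  exact map_smul (mfderiv 𝓘(ℝ, Euc m) (𝓡 m) (extChartAt (𝓡 m) q).symm y) (v i) _

lemma metric_ofCoord (h : RiemMetric m N) (q : N) (y v w : Euc m) :
    h.inner _ (ofCoord q y v) (ofCoord q y w) = ∑ a, ∑ b, gram h q y a b * v a * w b := by
  rw [ofCoord_eq_sum q y v, ofCoord_eq_sum q y w]
  simp only [map_sum, map_smul, sum_apply, smul_apply,
    smul_eq_mul, gram, Matrix.of_apply, Finset.mul_sum]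
  rw [Finset.sum_comm]
  refine Finset.sum_congr rfl fun a _ => Finset.sum_congr rfl fun b _ => ?_
  ring

/-- The metric pairing in coordinates. -/
lemma metric_eq_gram (h : RiemMetric m N) (q : N) {z : N} (hz : z ∈ (extChartAt (𝓡 m) q).source)
    (v w : TangentSpace (𝓡 m) z) :
    h.inner z v w = ∑ a, ∑ b, gram h q (extChartAt (𝓡 m) q z) a b
      * toCoord q z v a * toCoord q z w b := by
  obtain ⟨y, hy, rfl⟩ : ∃ y ∈ (extChartAt (𝓡 m) q).target, (extChartAt (𝓡 m) q).symm y = z :=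
    ⟨_, (extChartAt (𝓡 m) q).map_source hz, (extChartAt (𝓡 m) q).left_inv hz⟩
  rw [(extChartAt (𝓡 m) q).right_inv hy, ← metric_ofCoord, ofCoord_toCoord q hy,
    ofCoord_toCoord q hy]

/-- A kernel vector of the Gram matrix would give a tangent vector of length zero, nonzero because
the differential of the inverse chart is injective. -/
lemma isUnit_det_gram (h : RiemMetric m N) (q : N) {y : Euc m}
    (hy : y ∈ (extChartAt (𝓡 m) q).target) : IsUnit (gram h q y).det := by
  rw [isUnit_iff_ne_zero]
  intro h0
  obtain ⟨v, hv, hv'⟩ := Matrix.exists_mulVec_eq_zero_iff.2 h0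
  set u : Euc m := WithLp.toLp 2 v
  have hne : ofCoord q y u ≠ 0 := by
    intro h1
    have h2 := toCoord_ofCoord q hy u
    rw [h1] at h2
    apply hv
    have h3 : u = 0 := h2.symm.trans (map_zero (mfderiv (𝓡 m) 𝓘(ℝ, Euc m) (extChartAt (𝓡 m) q) _))
    simpa [u] using h3
  have hpos := h.pos _ _ hne
  rw [metric_ofCoord] at hpos
  have : ∑ a, ∑ b, gram h q y a b * u a * u b = 0 := by
    have h4 : ∀ a, ∑ b, gram h q y a b * u a * u b = u a * (gram h q y).mulVec v a := by
      intro a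
      simp only [Matrix.mulVec, dotProduct, Finset.mul_sum]
      exact Finset.sum_congr rfl fun b _ => by simp only [u]; ring
    simp [h4, hv']
  linarith

/-- The components of a smooth vector field along `φ` are smooth. -/
lemma contDiffAt_toCoord {φ : Spacetime → N} {V : ∀ p, TangentSpace (𝓡 m) (φ p)} {p : Spacetime}
    (hV : ContMDiffAt 𝓘(ℝ, Spacetime) (𝓡 m).tangent ∞
      (fun p => (⟨φ p, V p⟩ : TangentBundle (𝓡 m) N)) p) :
    ContDiffAt ℝ ∞ (fun p' => toCoord (φ p) (φ p') (V p')) p := by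
  have h1 := Bundle.contMDiffAt_totalSpace.1 hV
  have h2 : ContMDiffAt 𝓘(ℝ, Spacetime) 𝓘(ℝ, Euc m) ∞
    (fun p' => toCoord (φ p) (φ p') (V p')) p := by
    refine h1.2.congr_of_eventuallyEq ?_
    have hs : (chartAt (Euc m) (φ p)).source ∈ 𝓝 (φ p) := chart_source_mem_nhds _ _
    filter_upwards [h1.1.continuousAt.preimage_mem_nhds hs] with p' hp'
    have h3 := TangentBundle.continuousLinearMapAt_trivializationAt (I := 𝓡 m) (x₀ := φ p) hp'
    have h4 := DFunLike.congr_fun h3 (V p')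
    refine h4.symm.trans ?_
    rw [Bundle.Trivialization.continuousLinearMapAt_apply,
      Bundle.Trivialization.coe_linearMapAt_of_mem]
    exact hp'
  exact contMDiffAt_iff_contDiffAt.1 h2

end Target

/-! ### The connection in an orthonormal frame: skew-symmetry and zero torsion -/

lemma pderiv_eq_fderiv {F : Type*} [NormedAddCommGroup F] [NormedSpace ℝ F] (α : Fin 3)
    (f : Spacetime → F) {p : Spacetime} (hp : slab ∈ 𝓝 p) :
    pderiv α f p = fderiv ℝ f p (coordVec α) := by
  rw [pderiv, fderivWithin_of_mem_nhds hp]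

/-- A connection with the lowered symbols of a metric is compatible with it: its matrix in an
orthonormal frame is skew-symmetric. -/
lemma connection_matrix_skew {m : ℕ} {g : Fin m → Fin m → ℝ} {dg Γ : Fin m → Fin m → Fin m → ℝ}
    {E dE : Fin m → Fin m → ℝ} {Y : Fin m → ℝ} {A : Fin m → Fin m → ℝ}
    (hg : ∀ a b, g a b = g b a) (hdg : ∀ c a b, dg c a b = dg c b a)
    (hΓ : ∀ b c d, ∑ a, g b a * Γ a c d = (1 / 2) * (dg c b d + dg d b c - dg b c d))
    (horth : ∀ i j, ∑ a, ∑ b, g a b * E i a * E j b = if i = j then 1 else 0)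
    (hder : ∀ i j, ∑ a, ∑ b, ((∑ c, dg c a b * Y c) * E i a * E j b
      + g a b * dE i a * E j b + g a b * E i a * dE j b) = 0)
    (hcov : ∀ i a, dE i a + ∑ b, ∑ c, Γ a b c * Y b * E i c = ∑ k, A k i * E k a)
    (i j : Fin m) : A j i = -A i j := by
  have hdE : ∀ i a, dE i a = ∑ k, A k i * E k a - ∑ b, ∑ c, Γ a b c * Y b * E i c := by
    intro i a; linarith [hcov i a]
  -- `P i j` is the pairing of `Γ(Y, E_i)` with `E_j`, so that `g(dE_i, E_j) = A j i - P i j`.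
  set P : Fin m → Fin m → ℝ := fun i j => ∑ b, ∑ d, ∑ c,
    (1 / 2) * (dg c b d + dg d b c - dg b c d) * Y c * E i d * E j b with hP
  have hB : ∀ i j, ∑ a, ∑ b, g a b * dE i a * E j b = A j i - P i j := by
    intro i j
    have h1 : ∑ a, ∑ b, g a b * (∑ k, A k i * E k a) * E j b = A j i := by
      calc _ = ∑ k, A k i * ∑ a, ∑ b, g a b * E k a * E j b := by
            simp only [Finset.mul_sum, Finset.sum_mul]
            rw [Finset.sum_comm_cycle]
            refine Finset.sum_congr rfl fun _ _ => Finset.sum_congr rfl fun _ _ =>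
              Finset.sum_congr rfl fun _ _ => by ring
        _ = A j i := by simp [horth]
    have h2 : ∑ a, ∑ b, g a b * (∑ c, ∑ d, Γ a c d * Y c * E i d) * E j b = P i j := by
      calc _ = ∑ b, ∑ d, ∑ c, (∑ a, g b a * Γ a c d) * Y c * E i d * E j b := by
            rw [Finset.sum_comm]
            refine Finset.sum_congr rfl fun b _ => ?_
            simp only [Finset.mul_sum, Finset.sum_mul]
            rw [Finset.sum_comm_cycle]
            refine Finset.sum_congr rfl fun d _ => ?_
            rw [Finset.sum_comm]
            refine Finset.sum_congr rfl fun c _ => Finset.sum_congr rfl fun a _ => ?_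
            rw [hg a b]; ring
        _ = P i j := by simp only [hΓ, hP]
    rw [← h1, ← h2, ← Finset.sum_sub_distrib]
    refine Finset.sum_congr rfl fun a _ => ?_
    rw [← Finset.sum_sub_distrib]
    refine Finset.sum_congr rfl fun b _ => ?_
    rw [hdE]; ring
  have hB' : ∑ a, ∑ b, g a b * E i a * dE j b = A i j - P j i := by
    rw [← hB j i, Finset.sum_comm]
    refine Finset.sum_congr rfl fun a _ => Finset.sum_congr rfl fun b _ => ?_
    rw [hg a b]; ring
  -- Metric compatibility: on symmetrizing, two of the three terms of the lowered Christoffel symbol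
  -- cancel and the derivative of `g` along `Y` remains.
  have hPP : ∑ a, ∑ b, (∑ c, dg c a b * Y c) * E i a * E j b = P i j + P j i := by
    have : P j i = ∑ b, ∑ d, ∑ c,
        (1 / 2) * (dg c d b + dg b d c - dg d c b) * Y c * E j b * E i d := by
      rw [hP]; exact Finset.sum_comm
    rw [this, hP, Finset.sum_comm, ← Finset.sum_add_distrib]
    refine Finset.sum_congr rfl fun b _ => ?_
    rw [← Finset.sum_add_distrib]
    refine Finset.sum_congr rfl fun d _ => ?_
    rw [← Finset.sum_add_distrib, Finset.sum_mul, Finset.sum_mul]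
    refine Finset.sum_congr rfl fun c _ => ?_
    rw [hdg c b d, hdg d b c, hdg b d c]; ring
  have h := hder i j
  simp only [Finset.sum_add_distrib] at h
  rw [hB, hB', hPP] at h
  linarith

section Target

variable {m : ℕ} {N : Type*} [TopologicalSpace N] [ChartedSpace (Euc m) N]
  [IsManifold (𝓡 m) ∞ N]

/-- Lowering the upper index cancels the inverse Gram matrix; this is the form that
`connection_matrix_skew` takes. -/
lemma sum_gram_mul_christoffel (h : RiemMetric m N) (q : N) {y : Euc m}
    (hy : y ∈ (extChartAt (𝓡 m) q).target) (b c d : Fin m) :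
    ∑ a, gram h q y b a * christoffel h q y a c d = (1 / 2) *
      (fderiv ℝ (fun z => gram h q z b d) y (EuclideanSpace.single c 1)
      + fderiv ℝ (fun z => gram h q z b c) y (EuclideanSpace.single d 1)
      - fderiv ℝ (fun z => gram h q z c d) y (EuclideanSpace.single b 1)) := by
  have hinv : ∀ k, ∑ a, gram h q y b a * (gram h q y)⁻¹ a k = if b = k then 1 else 0 := by
    intro k
    rw [← Matrix.one_apply, ← Matrix.mul_nonsing_inv _ (isUnit_det_gram h q hy), Matrix.mul_apply]
  set F : Fin m → ℝ := fun k => fderiv ℝ (fun z => gram h q z k d) y (EuclideanSpace.single c 1)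
      + fderiv ℝ (fun z => gram h q z k c) y (EuclideanSpace.single d 1)
      - fderiv ℝ (fun z => gram h q z c d) y (EuclideanSpace.single k 1) with hF
  have : ∑ a, gram h q y b a * christoffel h q y a c d
      = (1 / 2) * ∑ k, (∑ a, gram h q y b a * (gram h q y)⁻¹ a k) * F k := by
    simp only [christoffel, Finset.mul_sum, Finset.sum_mul]
    rw [Finset.sum_comm]
    refine Finset.sum_congr rfl fun _ _ => Finset.sum_congr rfl fun _ _ => by ring
  rw [this]
  simp [hinv, hF]

lemma christoffel_symm (h : RiemMetric m N) (q : N) (y : Euc m) (a b c : Fin m) :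
    christoffel h q y a b c = christoffel h q y a c b := by
  have : (fun z => gram h q z b c) = fun z => gram h q z c b := funext fun z => gram_symm h q z b c
  simp only [christoffel, this]
  congr 1
  exact Finset.sum_congr rfl fun _ _ => by ring

lemma toCoord_mapDeriv {φ : Spacetime → N} {p : Spacetime} (q : N) (hs : slab ∈ 𝓝 p)
    (hφ : MDifferentiableAt 𝓘(ℝ, Spacetime) (𝓡 m) φ p)
    (hq : φ p ∈ (extChartAt (𝓡 m) q).source) (α : Fin 3) :
    toCoord q (φ p) (mapDeriv φ α p)
      = fderiv ℝ (fun p' => extChartAt (𝓡 m) q (φ p')) p (coordVec α) := by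
  have h1 : MDifferentiableAt (𝓡 m) 𝓘(ℝ, Euc m) (extChartAt (𝓡 m) q) (φ p) :=
    mdifferentiableAt_extChartAt (by rwa [extChartAt_source] at hq)
  have h2 := mfderiv_comp p h1 hφ
  rw [mapDeriv, mfderivWithin_of_mem_nhds hs, ← mfderiv_eq_fderiv]
  exact (DFunLike.congr_fun h2 (coordVec α)).symm

end Target

lemma hasFDerivAt_coord {m : ℕ} {X : Type*} [NormedAddCommGroup X] [NormedSpace ℝ X]
    {f : X → Euc m} {f' : X →L[ℝ] Euc m} {x : X} (hf : HasFDerivAt f f' x) (a : Fin m) :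
    HasFDerivAt (fun x => f x a) ((EuclideanSpace.proj a : Euc m →L[ℝ] ℝ) ∘L f') x :=
  (EuclideanSpace.proj a : Euc m →L[ℝ] ℝ).hasFDerivAt.comp x hf

section Target

variable {m : ℕ} {N : Type*} [TopologicalSpace N] [ChartedSpace (Euc m) N]
  [IsManifold (𝓡 m) ∞ N] {h : RiemMetric m N} {φ : Spacetime → N}
  {e : Fin m → ∀ p, TangentSpace (𝓡 m) (φ p)} {ψ : Fin 3 → Spacetime → Euc m}
  {A : Fin 3 → Spacetime → Matrix (Fin m) (Fin m) ℝ}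

/-- The components of the derivative of a smooth map in a smooth orthonormal frame are smooth. -/
lemma contDiffOn_of_frame (hφ : ContMDiffOn 𝓘(ℝ, Spacetime) (𝓡 m) ∞ φ slab)
    (he : IsOrthonormalFrame h φ e)
    (hψ : ∀ p ∈ slab, ∀ α, mapDeriv φ α p = ∑ i, ψ α p i • e i p) (α : Fin 3) :
    ContDiffOn ℝ ∞ (ψ α) slab := by
  rw [contDiffOn_euclidean]
  intro i
  refine (contDiffOn_metric h (contMDiffOn_mapDeriv hφ α) (he.smooth i)).congr fun p hp => ?_
  rw [hψ p hp α]
  simp [map_sum, map_smul, sum_apply, smul_apply, he.orthonormal p hp]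

/-- The chart stays fixed at `φ p` while the point varies, so that orthonormality can be
differentiated at `p`. -/
lemma metric_frame_eventually (hφ : ContMDiffOn 𝓘(ℝ, Spacetime) (𝓡 m) ∞ φ slab)
    (he : IsOrthonormalFrame h φ e) {p : Spacetime} (hp : slab ∈ 𝓝 p) (i j : Fin m) :
    ∀ᶠ p' in 𝓝 p, ∑ a, ∑ b, gram h (φ p) (extChartAt (𝓡 m) (φ p) (φ p')) a b
      * toCoord (φ p) (φ p') (e i p') a * toCoord (φ p) (φ p') (e j p') b
      = if i = j then 1 else 0 := by
  have hc : ContinuousAt φ p := (hφ.continuousOn).continuousAt hp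
  filter_upwards [hp, hc.preimage_mem_nhds (extChartAt_source_mem_nhds (I := 𝓡 m) (φ p))]
    with p' hp' hs
  rw [← metric_eq_gram h (φ p) hs, he.orthonormal p' hp']

lemma contDiffAt_chart (hφ : ContMDiffOn 𝓘(ℝ, Spacetime) (𝓡 m) ∞ φ slab) {p : Spacetime}
    (hp : slab ∈ 𝓝 p) : ContDiffAt ℝ ∞ (fun p' => extChartAt (𝓡 m) (φ p) (φ p')) p := by
  have h1 : ContMDiffAt (𝓡 m) 𝓘(ℝ, Euc m) ∞ (extChartAt (𝓡 m) (φ p)) (φ p) :=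
    contMDiffAt_extChartAt
  exact contMDiffAt_iff_contDiffAt.1 (h1.comp p (hφ.contMDiffAt hp))

lemma covDeriv_frame_coord {p : Spacetime} {α : Fin 3} {i : Fin m}
    (hA : covDeriv h φ (e i) α p = ∑ j, A α p j i • e j p) (a : Fin m) :
    pderiv α (fun p' => toCoord (φ p) (φ p') (e i p') a) p
      + ∑ b, ∑ c, christoffel h (φ p) (extChartAt (𝓡 m) (φ p) (φ p)) a b c
          * pderiv α (fun p' => extChartAt (𝓡 m) (φ p) (φ p') b) p
          * toCoord (φ p) (φ p) (e i p) c
      = ∑ j, A α p j i * toCoord (φ p) (φ p) (e j p) a := by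
  have h1 := congrArg (toCoord (φ p) (φ p)) hA
  rw [toCoord_sum_smul, toCoord_self] at h1
  have h2 := congrArg (fun v : Euc m => v a) h1
  simpa [covDeriv] using h2

/-- The connection matrix of the Levi-Civita connection in an orthonormal frame is skew. -/
theorem connection_skew (hφ : ContMDiffOn 𝓘(ℝ, Spacetime) (𝓡 m) ∞ φ slab)
    (he : IsOrthonormalFrame h φ e)
    (hA : ∀ p ∈ slab, ∀ α i, covDeriv h φ (e i) α p = ∑ j, A α p j i • e j p)
    {p : Spacetime} (hp : slab ∈ 𝓝 p) (α : Fin 3) (i j : Fin m) :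
    A α p j i = -A α p i j := by
  have hps : p ∈ slab := mem_of_mem_nhds hp
  set y : Spacetime → Euc m := fun p' => extChartAt (𝓡 m) (φ p) (φ p') with hy
  set E : Fin m → Spacetime → Euc m := fun i p' => toCoord (φ p) (φ p') (e i p') with hE
  have hyt : y p ∈ (extChartAt (𝓡 m) (φ p)).target := mem_extChartAt_target (φ p)
  have hyd : DifferentiableAt ℝ y p := (contDiffAt_chart hφ hp).differentiableAt (by simp)
  have hEd : ∀ i a, DifferentiableAt ℝ (fun p' => E i p' a) p := fun i a =>
    differentiableAt_euclidean.1 ((contDiffAt_toCoord ((he.smooth i).contMDiffAt hp)).differentiableAt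
      (by simp)) a
  have hgd : ∀ a b, DifferentiableAt ℝ (fun z => gram h (φ p) z a b) (y p) := fun a b =>
    ((contDiffOn_gram h (φ p) a b).contDiffAt
      ((isOpen_extChartAt_target (φ p)).mem_nhds hyt)).differentiableAt (by simp)
  refine connection_matrix_skew (g := gram h (φ p) (y p))
    (dg := fun c a b => fderiv ℝ (fun z => gram h (φ p) z a b) (y p) (EuclideanSpace.single c 1))
    (Γ := christoffel h (φ p) (y p)) (E := fun i a => E i p a)
    (dE := fun i a => pderiv α (fun p' => E i p' a) p)
    (Y := fun c => pderiv α (fun p' => y p' c) p) (A := A α p)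
    (gram_symm h (φ p) (y p)) ?_ (sum_gram_mul_christoffel h (φ p) hyt) ?_ ?_ ?_ i j
  · intro c a b
    have : (fun z => gram h (φ p) z a b) = fun z => gram h (φ p) z b a :=
      funext fun z => gram_symm h _ z a b
    rw [this]
  · intro i j
    exact (metric_frame_eventually hφ he hp i j).self_of_nhds
  · intro i j
    have hev := metric_frame_eventually hφ he hp i j
    have hd : ∀ a b, HasFDerivAt (fun p' => gram h (φ p) (y p') a b * E i p' a * E j p' b) _ p :=
      fun a b => ((((hgd a b).hasFDerivAt.comp p hyd.hasFDerivAt).mul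
        (hEd i a).hasFDerivAt).mul (hEd j b).hasFDerivAt)
    have hsum := HasFDerivAt.fun_sum (u := Finset.univ) fun a _ =>
      HasFDerivAt.fun_sum (u := Finset.univ) fun b _ => hd a b
    -- The pairing of two frame vectors is locally constant, so the derivative computed by the
    -- product rule is zero.
    have hz := hsum.unique ((hasFDerivAt_const (if i = j then (1 : ℝ) else 0) p).congr_of_eventuallyEq hev)
    have hz' := DFunLike.congr_fun hz (coordVec α)
    rw [← hz'.trans (zero_apply _)]
    simp only [sum_apply, add_apply, smul_apply, smul_eq_mul, ContinuousLinearMap.comp_apply]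
    refine Finset.sum_congr rfl fun a _ => Finset.sum_congr rfl fun b _ => ?_
    have hlin : fderiv ℝ (fun z => gram h (φ p) z a b) (y p) (fderiv ℝ y p (coordVec α))
        = ∑ c, fderiv ℝ (fun z => gram h (φ p) z a b) (y p) (EuclideanSpace.single c 1)
          * pderiv α (fun p' => y p' c) p := by
      have hv : ∀ v : Euc m, v = ∑ c, v c • EuclideanSpace.single c (1 : ℝ) := by
        intro v; ext b; simp [Finset.sum_apply, Pi.single_apply]
      conv_lhs => rw [hv (fderiv ℝ y p (coordVec α))]
      rw [map_sum]
      refine Finset.sum_congr rfl fun c _ => ?_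
      rw [map_smul, smul_eq_mul, mul_comm, pderiv_eq_fderiv _ _ hp]
      congr 1
      have := (hasFDerivAt_coord hyd.hasFDerivAt c).fderiv
      rw [this]; rfl
    simp only [Pi.mul_apply, Function.comp_apply]
    rw [hlin, pderiv_eq_fderiv _ _ hp, pderiv_eq_fderiv _ _ hp]
    ring
  · intro i a
    exact covDeriv_frame_coord (hA p hps α i) a

/-- The zero-torsion identity `D_α ψ_β = D_β ψ_α`. -/
theorem gaugeDeriv_comm (hφ : ContMDiffOn 𝓘(ℝ, Spacetime) (𝓡 m) ∞ φ slab)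
    (he : IsOrthonormalFrame h φ e)
    (hψ : ∀ p ∈ slab, ∀ α, mapDeriv φ α p = ∑ i, ψ α p i • e i p)
    (hA : ∀ p ∈ slab, ∀ α i, covDeriv h φ (e i) α p = ∑ j, A α p j i • e j p)
    {p : Spacetime} (hp : slab ∈ 𝓝 p) (α β : Fin 3) :
    gaugeDeriv A α (ψ β) p = gaugeDeriv A β (ψ α) p := by
  have hps : p ∈ slab := mem_of_mem_nhds hp
  set y : Spacetime → Euc m := fun p' => extChartAt (𝓡 m) (φ p) (φ p') with hy
  set E : Fin m → Spacetime → Euc m := fun i p' => toCoord (φ p) (φ p') (e i p') with hE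
  have hyc : ContDiffAt ℝ ∞ y p := contDiffAt_chart hφ hp
  have hEd : ∀ i a, DifferentiableAt ℝ (fun p' => E i p' a) p := fun i a =>
    differentiableAt_euclidean.1 ((contDiffAt_toCoord ((he.smooth i).contMDiffAt hp)).differentiableAt
      (by simp)) a
  have hψd : ∀ β i, DifferentiableAt ℝ (fun p' => ψ β p' i) p := fun β i =>
    differentiableAt_euclidean.1
      (((contDiffOn_of_frame hφ he hψ β).contDiffAt hp).differentiableAt (by simp)) i
  have hYev : ∀ β, ∀ᶠ p' in 𝓝 p,
      fderiv ℝ y p' (coordVec β) = ∑ i, ψ β p' i • E i p' := by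
    intro β
    have hc : ContinuousAt φ p := (hφ.continuousOn).continuousAt hp
    filter_upwards [eventually_mem_nhds_iff.2 hp,
      hc.preimage_mem_nhds (extChartAt_source_mem_nhds (I := 𝓡 m) (φ p))] with p' hp' hs
    rw [← toCoord_mapDeriv (φ p) hp' ((hφ.contMDiffAt hp').mdifferentiableAt (by simp)) hs,
      hψ p' (mem_of_mem_nhds hp') β, toCoord_sum_smul]
  have hY : ∀ β a, pderiv β (fun p' => y p' a) p = ∑ i, ψ β p i * E i p a := by
    intro β a
    have h1 := (hasFDerivAt_coord (hyc.differentiableAt (by simp)).hasFDerivAt a).fderiv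
    rw [pderiv_eq_fderiv _ _ hp, h1]
    have h2 := congrArg (fun v : Euc m => v a) (hYev β).self_of_nhds
    simpa using h2
  have hyd : DifferentiableAt ℝ (fderiv ℝ y) p :=
    (hyc.fderiv_right (m := 1) (by norm_cast)).differentiableAt (by simp)
  -- Differentiating `∂_β y = ∑ ψ_β^i E_i` near `p` expresses the Hessian of `φ` in the chart.
  have hH : ∀ α β a, fderiv ℝ (fderiv ℝ y) p (coordVec α) (coordVec β) a
      = ∑ i, (pderiv α (fun p' => ψ β p' i) p * E i p a
          + ψ β p i * pderiv α (fun p' => E i p' a) p) := by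
    intro α β a
    have h1 : HasFDerivAt (fun p' => fderiv ℝ y p' (coordVec β))
        ((fderiv ℝ (fderiv ℝ y) p).flip (coordVec β)) p := by
      simpa using hyd.hasFDerivAt.clm_apply (hasFDerivAt_const (coordVec β) p)
    have h2 := hasFDerivAt_coord h1 a
    have h3 : HasFDerivAt (fun p' => ∑ i, ψ β p' i * E i p' a) _ p :=
      HasFDerivAt.fun_sum (u := Finset.univ) fun i _ =>
        (hψd β i).hasFDerivAt.mul (hEd i a).hasFDerivAt
    have h4 : (fun p' => fderiv ℝ y p' (coordVec β) a) =ᶠ[𝓝 p]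
        fun p' => ∑ i, ψ β p' i * E i p' a := by
      filter_upwards [hYev β] with p' hp'
      rw [hp']; simp
    have h5 := DFunLike.congr_fun (h2.unique (h3.congr_of_eventuallyEq h4)) (coordVec α)
    refine Eq.trans ?_ (h5.trans ?_)
    · rfl
    · simp only [sum_apply, add_apply, smul_apply, smul_eq_mul]
      refine Finset.sum_congr rfl fun i _ => ?_
      rw [pderiv_eq_fderiv _ _ hp, pderiv_eq_fderiv _ _ hp]; ring
  have hsymm : IsSymmSndFDerivAt ℝ y p := hyc.isSymmSndFDerivAt (by simp; norm_cast)
  have hDcoord : ∀ α β j, gaugeDeriv A α (ψ β) p j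
      = pderiv α (fun p' => ψ β p' j) p + ∑ i, A α p j i * ψ β p i := by
    intro α β j
    have h1 := (hasFDerivAt_coord
      (((contDiffOn_of_frame hφ he hψ β).contDiffAt hp).differentiableAt (by simp)).hasFDerivAt j).fderiv
    rw [pderiv_eq_fderiv _ _ hp, h1, gaugeDeriv, pderiv_eq_fderiv _ _ hp]
    simp [Matrix.mulVec, dotProduct]
  -- In the chart, `e D_α ψ_β` is the Hessian plus `Γ(∂_α φ, ∂_β φ)`. Both are symmetric in `α` and
  -- `β`.
  have key : ∀ α β a, ∑ j, gaugeDeriv A α (ψ β) p j * E j p a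
      = fderiv ℝ (fderiv ℝ y) p (coordVec α) (coordVec β) a
        + ∑ b, ∑ c, christoffel h (φ p) (y p) a b c * (∑ i, ψ α p i * E i p b)
          * (∑ i, ψ β p i * E i p c) := by
    intro α β a
    rw [hH]
    have hcov : ∀ i, pderiv α (fun p' => E i p' a) p = ∑ j, A α p j i * E j p a
        - ∑ b, ∑ c, christoffel h (φ p) (y p) a b c * (∑ i, ψ α p i * E i p b) * E i p c := by
      intro i
      have := covDeriv_frame_coord (hA p hps α i) a
      simp only [← hY]
      exact eq_sub_of_add_eq this
    simp only [hcov, hDcoord]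
    have e1 : ∑ i, ψ β p i * ∑ j, A α p j i * E j p a
        = ∑ j, (∑ i, A α p j i * ψ β p i) * E j p a := by
      simp only [Finset.mul_sum, Finset.sum_mul]
      rw [Finset.sum_comm]
      exact Finset.sum_congr rfl fun _ _ => Finset.sum_congr rfl fun _ _ => by ring
    have e2 : ∑ i, ψ β p i * ∑ b, ∑ c, christoffel h (φ p) (y p) a b c
          * (∑ i, ψ α p i * E i p b) * E i p c
        = ∑ b, ∑ c, christoffel h (φ p) (y p) a b c * (∑ i, ψ α p i * E i p b)
          * (∑ i, ψ β p i * E i p c) := by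
      generalize (fun b => ∑ i, ψ α p i * E i p b) = w
      simp only [Finset.mul_sum]
      rw [Finset.sum_comm]
      refine Finset.sum_congr rfl fun _ _ => ?_
      rw [Finset.sum_comm]
      exact Finset.sum_congr rfl fun _ _ => Finset.sum_congr rfl fun _ _ => by ring
    simp only [mul_sub, add_mul, Finset.sum_add_distrib, Finset.sum_sub_distrib]
    rw [e1, e2]
    ring
  have hdiff : ∀ a, ∑ j, (gaugeDeriv A α (ψ β) p j - gaugeDeriv A β (ψ α) p j) * E j p a = 0 := by
    intro a
    simp only [sub_mul, Finset.sum_sub_distrib, key]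
    rw [hsymm.eq (coordVec α) (coordVec β), sub_eq_zero]
    congr 1
    rw [Finset.sum_comm]
    refine Finset.sum_congr rfl fun _ _ => Finset.sum_congr rfl fun _ _ => ?_
    rw [christoffel_symm]; ring
  ext k
  rw [← sub_eq_zero]
  have horth := fun j => (metric_frame_eventually hφ he hp j k).self_of_nhds
  -- Pairing with the frame vector `E_k` isolates the `k`-th component.
  calc gaugeDeriv A α (ψ β) p k - gaugeDeriv A β (ψ α) p k
      = ∑ j, (gaugeDeriv A α (ψ β) p j - gaugeDeriv A β (ψ α) p j) *
          ∑ a, ∑ b, gram h (φ p) (y p) a b * E j p a * E k p b := by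
        simp only [hy, hE, horth]
        simp
    _ = ∑ a, ∑ b, gram h (φ p) (y p) a b * E k p b *
          ∑ j, (gaugeDeriv A α (ψ β) p j - gaugeDeriv A β (ψ α) p j) * E j p a := by
        simp only [Finset.mul_sum]
        rw [Finset.sum_comm]
        refine Finset.sum_congr rfl fun _ _ => ?_
        rw [Finset.sum_comm]
        exact Finset.sum_congr rfl fun _ _ => Finset.sum_congr rfl fun _ _ => by ring
    _ = 0 := by simp [hdiff]

end Target

/-! ### The divergence theorem for currents supported in the unit cylinder -/

lemma continuousOn_slab_slice {f : Spacetime → ℝ} (hf : ContinuousOn f slab) {t : ℝ}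
    (ht : t ∈ Ico (-1 : ℝ) 0) : Continuous fun x : Euc 2 => f (t, x) := by
  rw [← continuousOn_univ]
  exact hf.comp (by fun_prop) fun x _ => ⟨ht, mem_univ _⟩

lemma integrable_slab_slice {f : Spacetime → ℝ} (hf : ContinuousOn f slab)
    (h0 : ∀ p ∈ slab, 1 < ‖p.2‖ → f p = 0) {t : ℝ} (ht : t ∈ Ico (-1 : ℝ) 0) :
    Integrable fun x : Euc 2 => f (t, x) := by
  refine (continuousOn_slab_slice hf ht).integrable_of_hasCompactSupport
    (HasCompactSupport.intro (isCompact_closedBall (0 : Euc 2) 1) fun x hx => ?_)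
  exact h0 _ ⟨ht, mem_univ _⟩ (by simpa using hx)

lemma continuousOn_integral_slice {f : Spacetime → ℝ} (hf : ContinuousOn f slab)
    (h0 : ∀ p ∈ slab, 1 < ‖p.2‖ → f p = 0) {T : ℝ} (hT : T < 0) :
    ContinuousOn (fun t => ∫ x : Euc 2, f (t, x)) (Icc (-1) T) := by
  have hsub : Icc (-1) T ⊆ Ico (-1 : ℝ) 0 := fun t ht => ⟨ht.1, ht.2.trans_lt hT⟩
  refine continuousOn_integral_of_compact_support (isCompact_closedBall (0 : Euc 2) 1)
    (f := fun t x => f (t, x)) ?_ ?_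
  · exact hf.mono fun p hp => ⟨hsub hp.1, mem_univ _⟩
  · intro t x ht hx
    exact h0 _ ⟨hsub ht, mem_univ _⟩ (by simpa using hx)

/-- The integral over space of a spatial derivative of a compactly supported function vanishes. -/
lemma integral_spatial_deriv_eq_zero {f : Spacetime → ℝ} {t : ℝ} (v : Euc 2)
    (hf : ∀ x : Euc 2, ContDiffAt ℝ 1 f (t, x)) (h0 : ∀ x : Euc 2, 1 < ‖x‖ → f (t, x) = 0) :
    ∫ x : Euc 2, fderiv ℝ f (t, x) (0, v) = 0 := by
  set g : Euc 2 → ℝ := fun x => f (t, x) with hg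
  have hgc : ContDiff ℝ 1 g := contDiff_iff_contDiffAt.2 fun x =>
    (hf x).comp x (contDiff_const.prodMk contDiff_id).contDiffAt
  have hgs : HasCompactSupport g := HasCompactSupport.intro (isCompact_closedBall (0 : Euc 2) 1)
    fun x hx => h0 x (by simpa using hx)
  have hder : ∀ x, fderiv ℝ f (t, x) (0, v) = fderiv ℝ g x v := by
    intro x
    have h1 : HasFDerivAt (fun x : Euc 2 => ((t, x) : Spacetime))
        (ContinuousLinearMap.inr ℝ ℝ (Euc 2)) x := hasFDerivAt_prodMk_right t x
    have h2 := ((hf x).differentiableAt (by simp)).hasFDerivAt.comp x h1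
    have h3 : fderiv ℝ g x = fderiv ℝ f (t, x) ∘L ContinuousLinearMap.inr ℝ ℝ (Euc 2) := h2.fderiv
    rw [h3]; simp
  simp only [hder]
  have hg' : Continuous fun x => fderiv ℝ g x v :=
    (hgc.continuous_fderiv (by simp)).clm_apply continuous_const
  have hgi : Integrable fun x => fderiv ℝ g x v :=
    hg'.integrable_of_hasCompactSupport (hgs.fderiv_apply (𝕜 := ℝ) v)
  have := integral_mul_fderiv_eq_neg_fderiv_mul_of_integrable (μ := (volume : Measure (Euc 2)))
    (f := fun _ => (1 : ℝ)) (g := g) (v := v) (by simp) (by simpa using hgi)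
    (by simpa using hgc.continuous.integrable_of_hasCompactSupport hgs)
    (fun _ _ => by fun_prop) (fun x _ => hgc.differentiable (by simp) x)
  simpa using this

/-- Differentiation in time of the integral over space of a compactly supported function. -/
lemma hasDerivAt_integral_slice {f : Spacetime → ℝ} {t : ℝ} (ht : t ∈ Ioo (-1 : ℝ) 0)
    (hf : ∀ p, slab ∈ 𝓝 p → ContDiffAt ℝ 1 f p) (h0 : ∀ p ∈ slab, 1 < ‖p.2‖ → f p = 0) :
    HasDerivAt (fun t => ∫ x : Euc 2, f (t, x)) (∫ x : Euc 2, fderiv ℝ f (t, x) (1, 0)) t := by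
  obtain ⟨r, hr, hr'⟩ := Metric.isOpen_iff.1 isOpen_Ioo t ht
  set k : Set ℝ := Metric.closedBall t (r / 2) with hk
  have hks : k ⊆ Ioo (-1 : ℝ) 0 := (Metric.closedBall_subset_ball (by linarith)).trans hr'
  have hnh : ∀ s ∈ Ioo (-1 : ℝ) 0, ∀ x : Euc 2, slab ∈ 𝓝 ((s, x) : Spacetime) :=
    fun s hs x => slab_mem_nhds hs.1 hs.2
  have hfc : ContinuousOn (fun p => fderiv ℝ f p (1, 0)) (Ioo (-1 : ℝ) 0 ×ˢ univ) := by
    intro p hp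
    have := (hf p (hnh _ hp.1 p.2)).fderiv_right (m := 0) (by simp)
    exact (this.continuousAt.clm_apply continuousAt_const).continuousWithinAt
  have hcomp : IsCompact (k ×ˢ Metric.closedBall (0 : Euc 2) 1) :=
    (isCompact_closedBall _ _).prod (isCompact_closedBall _ _)
  obtain ⟨M, hM⟩ := hcomp.exists_bound_of_continuousOn
    (hfc.mono (prod_mono hks (subset_univ _)))
  have hslice : ∀ s ∈ Ioo (-1 : ℝ) 0, Continuous fun x : Euc 2 => f (s, x) := by
    intro s hs
    refine continuous_iff_continuousAt.2 fun x => ?_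
    exact (hf _ (hnh s hs x)).continuousAt.comp (by fun_prop : ContinuousAt
      (fun x : Euc 2 => ((s, x) : Spacetime)) x)
  have hsupp : ∀ s ∈ Ioo (-1 : ℝ) 0, HasCompactSupport fun x : Euc 2 => f (s, x) := fun s hs =>
    HasCompactSupport.intro (isCompact_closedBall (0 : Euc 2) 1)
      fun x hx => h0 _ ⟨Ioo_subset_Ico_self hs, mem_univ _⟩ (by simpa using hx)
  have hz : ∀ s ∈ Ioo (-1 : ℝ) 0, ∀ x ∉ Metric.closedBall (0 : Euc 2) 1,
      fderiv ℝ f (s, x) = 0 := by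
    intro s hs x hx
    have : f =ᶠ[𝓝 (s, x)] fun _ => 0 := by
      have h1 : ∀ᶠ p : Spacetime in 𝓝 (s, x), 1 < ‖p.2‖ :=
        (continuous_snd.norm.isOpen_preimage _ isOpen_Ioi).mem_nhds (by simpa using hx)
      filter_upwards [h1, hnh s hs x] with p hp hp'
      exact h0 p hp' hp
    rw [this.fderiv_eq]; simp
  refine (hasDerivAt_integral_of_dominated_loc_of_deriv_le (s := k) (μ := volume)
    (F := fun t x => f (t, x)) (F' := fun t x => fderiv ℝ f (t, x) (1, 0))
    (bound := (Metric.closedBall (0 : Euc 2) 1).indicator fun _ => M)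
    (Metric.closedBall_mem_nhds t (by linarith)) ?_ ?_ ?_ ?_ ?_ ?_).2
  · filter_upwards [isOpen_Ioo.mem_nhds ht] with s hs
    exact (hslice s hs).aestronglyMeasurable
  · exact (hslice t ht).integrable_of_hasCompactSupport (hsupp t ht)
  · refine Continuous.aestronglyMeasurable ?_
    rw [← continuousOn_univ]
    exact hfc.comp (by fun_prop) fun x _ => ⟨ht, mem_univ _⟩
  · refine Eventually.of_forall fun x s hs => ?_
    by_cases hx : x ∈ Metric.closedBall (0 : Euc 2) 1
    · rw [indicator_of_mem hx]
      exact hM (s, x) ⟨hs, hx⟩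
    · rw [indicator_of_notMem hx, hz s (hks hs) x hx]; simp
  · exact (integrable_indicator_iff measurableSet_closedBall).2
      (integrableOn_const (isCompact_closedBall _ _).measure_lt_top.ne)
  · refine Eventually.of_forall fun x s hs => ?_
    have h1 : HasFDerivAt f (fderiv ℝ f (s, x)) (s, x) :=
      ((hf _ (hnh s (hks hs) x)).differentiableAt (by simp)).hasFDerivAt
    have h2 : HasDerivAt (fun s : ℝ => ((s, x) : Spacetime)) (1, 0) s :=
      (hasDerivAt_id s).prodMk (hasDerivAt_const s x)
    exact h1.comp_hasDerivAt s h2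

/-- The divergence theorem on `[-1, T] × ℝ²` for a current supported in `|x| ≤ 1`. -/
theorem integral_divergence_slab {P : Fin 3 → Spacetime → ℝ} {R : Spacetime → ℝ}
    (hP : ContinuousOn (P 0) slab) (hP' : ∀ α p, slab ∈ 𝓝 p → ContDiffAt ℝ 1 (P α) p)
    (hP0 : ∀ α, ∀ p ∈ slab, 1 < ‖p.2‖ → P α p = 0)
    (hR : ContinuousOn R slab) (hR0 : ∀ p ∈ slab, 1 < ‖p.2‖ → R p = 0)
    (hdiv : ∀ p, slab ∈ 𝓝 p → ∑ α, minkowski α * fderiv ℝ (P α) p (coordVec α) = R p)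
    {T : ℝ} (hT : T ∈ Ioo (-1 : ℝ) 0) :
    ∫ t in (-1 : ℝ)..T, ∫ x : Euc 2, R (t, x)
      = (∫ x : Euc 2, P 0 (-1, x)) - ∫ x : Euc 2, P 0 (T, x) := by
  have hder : ∀ t ∈ Ioo (-1 : ℝ) T, HasDerivAt (fun t => ∫ x : Euc 2, P 0 (t, x))
      (-∫ x : Euc 2, R (t, x)) t := by
    intro t ht
    have ht' : t ∈ Ioo (-1 : ℝ) 0 := ⟨ht.1, ht.2.trans hT.2⟩
    have hnh : ∀ x : Euc 2, slab ∈ 𝓝 ((t, x) : Spacetime) :=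
      fun x => slab_mem_nhds ht'.1 ht'.2
    have hderInt : ∀ j : Fin 2, Integrable fun x : Euc 2 =>
        fderiv ℝ (P j.succ) (t, x) (0, EuclideanSpace.single j 1) := by
      intro j
      refine Continuous.integrable_of_hasCompactSupport ?_
        (HasCompactSupport.intro (isCompact_closedBall (0 : Euc 2) 1) fun x hx => ?_)
      · refine continuous_iff_continuousAt.2 fun x => ?_
        have h1 := ((hP' j.succ _ (hnh x)).fderiv_right (m := 0) (by simp)).continuousAt
        exact (h1.comp (by fun_prop : ContinuousAt
          (fun x : Euc 2 => ((t, x) : Spacetime)) x)).clm_apply continuousAt_const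
      · have : P j.succ =ᶠ[𝓝 (t, x)] fun _ => 0 := by
          have h1 : ∀ᶠ p : Spacetime in 𝓝 (t, x), 1 < ‖p.2‖ :=
            (continuous_snd.norm.isOpen_preimage _ isOpen_Ioi).mem_nhds (by simpa using hx)
          filter_upwards [h1, hnh x] with p hp hp'
          exact hP0 _ p hp' hp
        rw [this.fderiv_eq]; simp
    have hzero : ∀ j : Fin 2, ∫ x : Euc 2,
        fderiv ℝ (P j.succ) (t, x) (0, EuclideanSpace.single j 1) = 0 := fun j =>
      integral_spatial_deriv_eq_zero _ (fun x => hP' _ _ (hnh x))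
        fun x hx => hP0 _ _ ⟨Ioo_subset_Ico_self ht', mem_univ _⟩ hx
    have hRi : Integrable fun x : Euc 2 => R (t, x) :=
      integrable_slab_slice hR hR0 (Ioo_subset_Ico_self ht')
    convert hasDerivAt_integral_slice ht' (hP' 0) (hP0 0) using 1
    -- The sign `η_00 = -1` puts the time derivative on the other side, with the source `R`
    -- subtracted; the spatial terms integrate to zero.
    have heq : ∀ x : Euc 2, fderiv ℝ (P 0) (t, x) (1, 0)
        = fderiv ℝ (P (Fin.succ 0)) (t, x) (0, EuclideanSpace.single 0 1)
          + fderiv ℝ (P (Fin.succ 1)) (t, x) (0, EuclideanSpace.single 1 1) - R (t, x) := by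
      intro x
      have := hdiv _ (hnh x)
      simp [Fin.sum_univ_three, minkowski, coordVec] at this
      simp; linarith
    simp only [heq]
    have h01 : Integrable fun x : Euc 2 =>
        fderiv ℝ (P (Fin.succ 0)) (t, x) (0, EuclideanSpace.single 0 1)
          + fderiv ℝ (P (Fin.succ 1)) (t, x) (0, EuclideanSpace.single 1 1) :=
      (hderInt 0).add (hderInt 1)
    rw [integral_sub h01 hRi, integral_add (hderInt 0) (hderInt 1), hzero, hzero]
    simp
  have hc := continuousOn_integral_slice hP (hP0 0) hT.2
  have hRc := continuousOn_integral_slice hR hR0 hT.2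
  have := intervalIntegral.integral_eq_sub_of_hasDerivAt_of_le hT.1.le hc hder
    (hRc.neg.intervalIntegrable_of_Icc hT.1.le)
  rw [intervalIntegral.integral_neg] at this
  linarith

/-! ### Gauge identities, the stress-energy tensor and the divergence of the multiplier current -/

section

variable {m : ℕ}

/-- The differential identities of a derivative wave map, with `D α β` standing for the
gauge-covariant derivative `D_α ψ_β`. -/
structure SatisfiesGaugeIdentities (ψ : Fin 3 → Spacetime → Euc m)
    (D : Fin 3 → Fin 3 → Spacetime → Euc m) : Prop where
  contDiffOn : ∀ α, ContDiffOn ℝ ∞ (ψ α) slab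
  symm : ∀ p, slab ∈ 𝓝 p → ∀ α β, D α β p = D β α p
  wave : ∀ p, slab ∈ 𝓝 p → D 0 0 p = D 1 1 p + D 2 2 p
  inner_deriv : ∀ p, slab ∈ 𝓝 p → ∀ α β γ,
    fderiv ℝ (fun p => inner ℝ (ψ α p) (ψ β p)) p (coordVec γ)
      = inner ℝ (D γ α p) (ψ β p) + inner ℝ (ψ α p) (D γ β p)

lemma inner_mulVec_skew {B : Matrix (Fin m) (Fin m) ℝ} (hB : ∀ i j, B j i = -B i j) (u v : Euc m) :
    inner ℝ (WithLp.toLp 2 (B.mulVec u) : Euc m) v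
      + inner ℝ u (WithLp.toLp 2 (B.mulVec v) : Euc m) = 0 := by
  simp only [PiLp.inner_apply, Matrix.mulVec, dotProduct, RCLike.inner_apply, conj_trivial,
    Finset.sum_mul, Finset.mul_sum]
  rw [Finset.sum_comm, ← Finset.sum_add_distrib]
  refine Finset.sum_eq_zero fun i _ => ?_
  rw [← Finset.sum_add_distrib]
  refine Finset.sum_eq_zero fun j _ => ?_
  rw [hB i j]; ring

/-- Takes `D α β = D_α ψ_β`. Skewness of `A` removes the connection terms from the derivative of an
inner product. All later estimates use only these identities. -/
theorem IsSchwartzDerivativeWaveMap.exists_gaugeIdentities {N : Type*} [TopologicalSpace N]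
    [ChartedSpace (Euc m) N] [IsManifold (𝓡 m) ∞ N] {h : RiemMetric m N}
    {ψ : Fin 3 → Spacetime → Euc m} (hψ : IsSchwartzDerivativeWaveMap h ψ) :
    ∃ D, SatisfiesGaugeIdentities ψ D := by
  obtain ⟨φ, e, A, hφ, he, h1, h2, h3⟩ := hψ
  have hsm := contDiffOn_of_frame hφ.smooth he h1
  refine ⟨fun α β => gaugeDeriv A α (ψ β), hsm, fun p hp α β =>
    gaugeDeriv_comm hφ.smooth he h1 h2 hp α β, fun p hp => ?_, fun p hp α β γ => ?_⟩
  · have := h3 p (mem_of_mem_nhds hp)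
    simp only [Fin.sum_univ_three, minkowski] at this
    simp at this
    rw [← sub_eq_zero, ← neg_eq_zero, ← this]; abel
  · have hd : ∀ α, DifferentiableAt ℝ (ψ α) p := fun α =>
      ((hsm α).contDiffAt hp).differentiableAt (by simp)
    have hsk := inner_mulVec_skew (connection_skew hφ.smooth he h2 hp γ) (ψ α p) (ψ β p)
    rw [fderiv_inner_apply ℝ (hd α) (hd β)]
    simp only [gaugeDeriv, pderiv_eq_fderiv _ _ hp, inner_add_left, inner_add_right]
    linarith

/-- The stress-energy tensor `⟨ψ_α, ψ_β⟩ - ½ η_{αβ} ⟨ψ^γ, ψ_γ⟩`. -/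
def stress (ψ : Fin 3 → Spacetime → Euc m) (α β : Fin 3) (p : Spacetime) : ℝ :=
  inner ℝ (ψ α p) (ψ β p) - (if α = β then minkowski α / 2 else 0) *
    (-inner ℝ (ψ 0 p) (ψ 0 p) + inner ℝ (ψ 1 p) (ψ 1 p) + inner ℝ (ψ 2 p) (ψ 2 p))

/-- The weight `((1 + δ²) t² - |x|²)^{-1/2}`. -/
def weight (δ : ℝ) (p : Spacetime) : ℝ := (√((1 + δ ^ 2) * p.1 ^ 2 - ‖p.2‖ ^ 2))⁻¹

/-- The contraction of the stress-energy tensor with the vector field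
`C ∂_t + κ ((1 + δ²) t² - |x|²)^{-1/2} S`. -/
def current (ψ : Fin 3 → Spacetime → Euc m) (C κ δ : ℝ) (α : Fin 3) (p : Spacetime) : ℝ :=
  C * stress ψ α 0 p + κ * weight δ p *
    (p.1 * stress ψ α 0 p + p.2 0 * stress ψ α 1 p + p.2 1 * stress ψ α 2 p)

/-- The divergence of `current ψ C κ δ`, up to the factor `κ`. -/
def production (ψ : Fin 3 → Spacetime → Euc m) (δ : ℝ) (p : Spacetime) : ℝ :=
  weight δ p ^ 3 * (‖scalingComponent ψ p‖ ^ 2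
    + δ ^ 2 * (p.1 * inner ℝ (ψ 0 p) (scalingComponent ψ p)))

lemma norm_sq_euc_two (x : Euc 2) : ‖x‖ ^ 2 = x 0 ^ 2 + x 1 ^ 2 := by
  rw [EuclideanSpace.real_norm_sq_eq, Fin.sum_univ_two]

section Derivatives

variable {ψ : Fin 3 → Spacetime → Euc m} {D : Fin 3 → Fin 3 → Spacetime → Euc m}

lemma contDiffOn_stress (hψ : ∀ α, ContDiffOn ℝ ∞ (ψ α) slab) (α β : Fin 3) :
    ContDiffOn ℝ ∞ (stress ψ α β) slab := by
  have hi : ∀ α β, ContDiffOn ℝ ∞ (fun p => inner ℝ (ψ α p) (ψ β p)) slab :=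
    fun α β => (hψ α).inner ℝ (hψ β)
  exact (hi α β).sub (contDiffOn_const.mul (((hi 0 0).neg.add (hi 1 1)).add (hi 2 2)))

lemma stress_symm (α β : Fin 3) (p : Spacetime) : stress ψ α β p = stress ψ β α p := by
  simp only [stress, real_inner_comm (ψ α p), eq_comm (a := α)]
  split_ifs with h
  · rw [h]
  · rfl

lemma stress_zero_zero (p : Spacetime) : stress ψ 0 0 p = (inner ℝ (ψ 0 p) (ψ 0 p)
    + inner ℝ (ψ 1 p) (ψ 1 p) + inner ℝ (ψ 2 p) (ψ 2 p)) / 2 := by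
  simp [stress, minkowski]; ring

lemma stress_one_one (p : Spacetime) : stress ψ 1 1 p = (inner ℝ (ψ 0 p) (ψ 0 p)
    + inner ℝ (ψ 1 p) (ψ 1 p) - inner ℝ (ψ 2 p) (ψ 2 p)) / 2 := by
  simp [stress, minkowski]; ring

lemma stress_two_two (p : Spacetime) : stress ψ 2 2 p = (inner ℝ (ψ 0 p) (ψ 0 p)
    - inner ℝ (ψ 1 p) (ψ 1 p) + inner ℝ (ψ 2 p) (ψ 2 p)) / 2 := by
  simp [stress, minkowski]; ring

lemma stress_of_ne {α β : Fin 3} (h : α ≠ β) (p : Spacetime) :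
    stress ψ α β p = inner ℝ (ψ α p) (ψ β p) := by
  simp [stress, h]

/-- The stress-energy tensor of a wave map is divergence free. -/
lemma divergence_stress (hψ : SatisfiesGaugeIdentities ψ D) {p : Spacetime} (hp : slab ∈ 𝓝 p)
    (β : Fin 3) :
    ∑ α, minkowski α * fderiv ℝ (stress ψ α β) p (coordVec α) = 0 := by
  have hi : ∀ α β, DifferentiableAt ℝ (fun p => inner ℝ (ψ α p) (ψ β p)) p := fun α β =>
    (((hψ.contDiffOn α).inner ℝ (hψ.contDiffOn β)).contDiffAt hp).differentiableAt (by simp)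
  have hd : ∀ α γ, fderiv ℝ (stress ψ α β) p (coordVec γ)
      = inner ℝ (D γ α p) (ψ β p) + inner ℝ (ψ α p) (D γ β p)
        - (if α = β then minkowski α / 2 else 0) *
          (2 * (-inner ℝ (D γ 0 p) (ψ 0 p) + inner ℝ (D γ 1 p) (ψ 1 p)
            + inner ℝ (D γ 2 p) (ψ 2 p))) := by
    intro α γ
    have h1 : HasFDerivAt (stress ψ α β) _ p := (hi α β).hasFDerivAt.sub
      (HasFDerivAt.const_mul (((hi 0 0).hasFDerivAt.neg.add (hi 1 1).hasFDerivAt).add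
        (hi 2 2).hasFDerivAt) (if α = β then minkowski α / 2 else 0))
    rw [h1.fderiv]
    simp only [sub_apply, add_apply, neg_apply, smul_apply, smul_eq_mul, hψ.inner_deriv p hp]
    rw [real_inner_comm (ψ 0 p) (D γ 0 p), real_inner_comm (ψ 1 p) (D γ 1 p),
      real_inner_comm (ψ 2 p) (D γ 2 p)]
    ring
  have h10 := hψ.symm p hp 1 0
  have h20 := hψ.symm p hp 2 0
  have h21 := hψ.symm p hp 2 1
  have hw : ∀ β, inner ℝ (D 0 0 p) (ψ β p) = inner ℝ (D 1 1 p) (ψ β p)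
      + inner ℝ (D 2 2 p) (ψ β p) := fun β => by rw [hψ.wave p hp, inner_add_left]
  simp only [Fin.sum_univ_three, hd]
  have hc : ∀ α γ δ, inner ℝ (ψ α p) (D γ δ p) = inner ℝ (D γ δ p) (ψ α p) := fun _ _ _ =>
    real_inner_comm _ _
  fin_cases β <;> simp [minkowski, hc, h10, h20, h21, hw] <;> ring

lemma inner_scalingComponent (p : Spacetime) :
    inner ℝ (ψ 0 p) (scalingComponent ψ p) = p.1 * inner ℝ (ψ 0 p) (ψ 0 p)
      + p.2 0 * inner ℝ (ψ 0 p) (ψ 1 p) + p.2 1 * inner ℝ (ψ 0 p) (ψ 2 p) := by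
  simp only [scalingComponent, inner_add_right, real_inner_smul_right]

lemma norm_sq_scalingComponent (p : Spacetime) :
    ‖scalingComponent ψ p‖ ^ 2 = p.1 ^ 2 * inner ℝ (ψ 0 p) (ψ 0 p)
      + p.2 0 ^ 2 * inner ℝ (ψ 1 p) (ψ 1 p) + p.2 1 ^ 2 * inner ℝ (ψ 2 p) (ψ 2 p)
      + 2 * p.1 * p.2 0 * inner ℝ (ψ 0 p) (ψ 1 p) + 2 * p.1 * p.2 1 * inner ℝ (ψ 0 p) (ψ 2 p)
      + 2 * p.2 0 * p.2 1 * inner ℝ (ψ 1 p) (ψ 2 p) := by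
  rw [← real_inner_self_eq_norm_sq]
  simp only [scalingComponent, inner_add_left, inner_add_right, real_inner_smul_left,
    real_inner_smul_right]
  rw [real_inner_comm (ψ 0 p) (ψ 1 p), real_inner_comm (ψ 0 p) (ψ 2 p),
    real_inner_comm (ψ 1 p) (ψ 2 p)]
  ring

/-- With the index raised, the gradient of `w` is `w³ (S + δ² t ∂_t)`. Its first part produces
`|ψ_S|²` in the divergence and its second part the error of size `δ²`. -/
lemma hasLineDerivAt_weight {δ : ℝ} {p : Spacetime} (hp : ‖p.2‖ ^ 2 < (1 + δ ^ 2) * p.1 ^ 2)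
    (γ : Fin 3) :
    HasLineDerivAt ℝ (weight δ)
      (weight δ p ^ 3 * ![-(1 + δ ^ 2) * p.1, p.2 0, p.2 1] γ) p (coordVec γ) := by
  set f : Spacetime → ℝ := fun p => (1 + δ ^ 2) * p.1 ^ 2 - (p.2 0 ^ 2 + p.2 1 ^ 2) with hf
  have hwf : weight δ = fun p => (√(f p))⁻¹ := by
    funext p; simp only [weight, hf, norm_sq_euc_two]
  have hpos : 0 < f p := by simp only [hf, ← norm_sq_euc_two]; linarith
  have hfd : HasDerivAt (fun r : ℝ => f (p + r • coordVec γ))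
      (-2 * ![-(1 + δ ^ 2) * p.1, p.2 0, p.2 1] γ) 0 := by
    have hl : ∀ a b : ℝ, HasDerivAt (fun r : ℝ => (a + r * b) ^ 2) (2 * a * b) 0 := by
      intro a b
      exact (((hasDerivAt_id (0 : ℝ)).mul_const b).const_add a |>.pow 2).congr_deriv (by simp)
    have := ((hl p.1 (coordVec γ).1).const_mul (1 + δ ^ 2)).sub
      ((hl (p.2 0) ((coordVec γ).2 0)).add (hl (p.2 1) ((coordVec γ).2 1)))
    simp only [hf]
    convert! this using 1
    fin_cases γ <;> simp [coordVec]
    ring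
  have hp0 : f (p + (0 : ℝ) • coordVec γ) = f p := by simp
  have hs := (hfd.sqrt (by rw [hp0]; exact hpos.ne')).inv
    (by rw [hp0]; exact (Real.sqrt_pos.2 hpos).ne')
  rw [hwf]
  unfold HasLineDerivAt
  convert! hs using 1
  rw [hp0]
  have := (Real.sqrt_pos.2 hpos).ne'
  field_simp

/-- The divergence of the current. -/
lemma divergence_current (hψ : SatisfiesGaugeIdentities ψ D) {δ : ℝ} {p : Spacetime}
    (hp : slab ∈ 𝓝 p) (hp' : ‖p.2‖ ^ 2 < (1 + δ ^ 2) * p.1 ^ 2) (C κ : ℝ)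
    (hd : ∀ α, DifferentiableAt ℝ (current ψ C κ δ α) p) :
    ∑ α, minkowski α * fderiv ℝ (current ψ C κ δ α) p (coordVec α) = κ * production ψ δ p := by
  have hT : ∀ α β γ, HasDerivAt (fun r : ℝ => stress ψ α β (p + r • coordVec γ))
      (fderiv ℝ (stress ψ α β) p (coordVec γ)) 0 := fun α β γ =>
    (((contDiffOn_stress hψ.contDiffOn α β).contDiffAt hp).differentiableAt
      (by simp)).hasFDerivAt.hasLineDerivAt _
  have hw : ∀ γ, HasDerivAt (fun r : ℝ => weight δ (p + r • coordVec γ)) _ 0 :=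
    hasLineDerivAt_weight hp'
  have hl : ∀ a b : ℝ, HasDerivAt (fun r : ℝ => a + r * b) b 0 := by
    intro a b
    simpa using ((hasDerivAt_id (0 : ℝ)).mul_const b).const_add a
  have hQ : ∀ α, fderiv ℝ (current ψ C κ δ α) p (coordVec α)
      = C * fderiv ℝ (stress ψ α 0) p (coordVec α)
        + κ * (weight δ p ^ 3 * ![-(1 + δ ^ 2) * p.1, p.2 0, p.2 1] α) *
          (p.1 * stress ψ α 0 p + p.2 0 * stress ψ α 1 p + p.2 1 * stress ψ α 2 p)
        + κ * weight δ p * (stress ψ α α p + p.1 * fderiv ℝ (stress ψ α 0) p (coordVec α)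
          + p.2 0 * fderiv ℝ (stress ψ α 1) p (coordVec α)
          + p.2 1 * fderiv ℝ (stress ψ α 2) p (coordVec α)) := by
    intro α
    have h1 : HasDerivAt (fun r : ℝ => current ψ C κ δ α (p + r • coordVec α)) _ 0 :=
      ((hT α 0 α).const_mul C).add (((hw α).const_mul κ).mul
        ((((hl p.1 (coordVec α).1).mul (hT α 0 α)).add
          ((hl (p.2 0) ((coordVec α).2 0)).mul (hT α 1 α))).add
            ((hl (p.2 1) ((coordVec α).2 1)).mul (hT α 2 α))))
    rw [((hd α).hasFDerivAt.hasLineDerivAt (coordVec α)).unique h1]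
    fin_cases α <;> simp [coordVec] <;> ring
  have hdiv := fun β => divergence_stress hψ hp β
  have hdiv0 := hdiv 0
  have hdiv1 := hdiv 1
  have hdiv2 := hdiv 2
  -- This relation makes the Lagrangian terms from `∂w` equal to `w/2 ⟨ψ^γ, ψ_γ⟩`, which the trace
  -- of `T`, equal to `-½ ⟨ψ^γ, ψ_γ⟩` in dimension 1+2, cancels.
  have hrho : weight δ p ^ 2 * ((1 + δ ^ 2) * p.1 ^ 2 - (p.2 0 ^ 2 + p.2 1 ^ 2)) = 1 := by
    rw [← norm_sq_euc_two, weight, inv_pow, Real.sq_sqrt (by linarith)]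
    exact inv_mul_cancel₀ (by linarith)
  simp only [Fin.sum_univ_three, hQ] at hdiv0 hdiv1 hdiv2 ⊢
  rw [stress_symm 1 0, stress_symm 2 0, stress_symm 2 1, production, norm_sq_scalingComponent,
    inner_scalingComponent]
  simp [minkowski] at hdiv0 hdiv1 hdiv2 ⊢
  simp only [← real_inner_self_eq_norm_sq]
  rw [stress_zero_zero, stress_one_one, stress_two_two, stress_of_ne (by decide : (0 : Fin 3) ≠ 1),
    stress_of_ne (by decide : (0 : Fin 3) ≠ 2), stress_of_ne (by decide : (1 : Fin 3) ≠ 2)]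
  linear_combination C * hdiv0 + κ * weight δ p * (p.1 * hdiv0 + p.2 0 * hdiv1 + p.2 1 * hdiv2)
    + κ * weight δ p * (-inner ℝ (ψ 0 p) (ψ 0 p) + inner ℝ (ψ 1 p) (ψ 1 p)
      + inner ℝ (ψ 2 p) (ψ 2 p)) / 2 * hrho

end Derivatives

end

section

variable {m : ℕ} {ψ : Fin 3 → Spacetime → Euc m} {D : Fin 3 → Fin 3 → Spacetime → Euc m}

/-! ### Dominant energy inequalities and the pointwise bound for `ψ_S` -/

section Pointwise

lemma stress_zero_zero_nonneg (p : Spacetime) : 0 ≤ stress ψ 0 0 p := by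
  rw [stress_zero_zero]
  have := real_inner_self_nonneg (x := ψ 0 p)
  have := real_inner_self_nonneg (x := ψ 1 p)
  have := real_inner_self_nonneg (x := ψ 2 p)
  linarith

/-- This is `|y ψ_1 - x ψ_2|²`, the angular part of the gradient, which is the remainder in both
energy inequalities below. -/
lemma norm_rotated_nonneg (x y : ℝ) (p : Spacetime) :
    0 ≤ y ^ 2 * inner ℝ (ψ 1 p) (ψ 1 p) - 2 * x * y * inner ℝ (ψ 1 p) (ψ 2 p)
      + x ^ 2 * inner ℝ (ψ 2 p) (ψ 2 p) := by
  have h := real_inner_self_nonneg (x := y • ψ 1 p - x • ψ 2 p)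
  simp only [inner_sub_left, inner_sub_right, real_inner_smul_left, real_inner_smul_right] at h
  rw [real_inner_comm (ψ 1 p) (ψ 2 p)] at h
  linarith

/-- The dominant energy condition for `∂_t` and a causal vector. -/
lemma momentum_le_energy {τ x y : ℝ} (hτ : 0 < τ) (hxy : x ^ 2 + y ^ 2 ≤ τ ^ 2) (p : Spacetime) :
    x * stress ψ 0 1 p + y * stress ψ 0 2 p ≤ τ * stress ψ 0 0 p := by
  rw [stress_zero_zero, stress_of_ne (by decide : (0 : Fin 3) ≠ 1),
    stress_of_ne (by decide : (0 : Fin 3) ≠ 2)]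
  have h1 := real_inner_self_nonneg (x := τ • ψ 0 p - x • ψ 1 p - y • ψ 2 p)
  simp only [inner_sub_left, inner_sub_right, real_inner_smul_left, real_inner_smul_right] at h1
  rw [real_inner_comm (ψ 0 p) (ψ 1 p), real_inner_comm (ψ 0 p) (ψ 2 p),
    real_inner_comm (ψ 1 p) (ψ 2 p)] at h1
  have h2 := norm_rotated_nonneg (ψ := ψ) x y p
  have h3 := mul_nonneg (sub_nonneg.2 hxy) (add_nonneg (real_inner_self_nonneg (x := ψ 1 p))
    (real_inner_self_nonneg (x := ψ 2 p)))
  refine le_of_mul_le_mul_left ?_ (mul_pos two_pos hτ)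
  linarith

/-- The component of the stress-energy tensor along the scaling field is controlled by the energy
flux through the cone. -/
lemma stress_scaling_le {t x y : ℝ} (hxy : x ^ 2 + y ^ 2 ≤ t ^ 2) (p : Spacetime) :
    t * (t * stress ψ 0 0 p + x * stress ψ 0 1 p + y * stress ψ 0 2 p)
      + x * (t * stress ψ 0 1 p + x * stress ψ 1 1 p + y * stress ψ 1 2 p)
      + y * (t * stress ψ 0 2 p + x * stress ψ 1 2 p + y * stress ψ 2 2 p)
    ≤ 2 * t * (t * stress ψ 0 0 p + x * stress ψ 0 1 p + y * stress ψ 0 2 p) := by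
  have h2 := norm_rotated_nonneg (ψ := ψ) x y p
  have h3 := mul_nonneg (sub_nonneg.2 hxy) (stress_zero_zero_nonneg (ψ := ψ) p)
  rw [stress_zero_zero] at h3 ⊢
  rw [stress_one_one, stress_two_two, stress_of_ne (by decide : (1 : Fin 3) ≠ 2)]
  linarith

variable {C κ δ : ℝ} {p : Spacetime}

lemma weight_nonneg (δ : ℝ) (p : Spacetime) : 0 ≤ weight δ p := by
  unfold weight; positivity

/-- `S` is causal and past-directed when `t < 0`, so `T(∂_t, S) ≤ 0`. -/
lemma current_zero_le (hκ : 0 ≤ κ) (ht : p.1 < 0) (hp : ‖p.2‖ ^ 2 ≤ p.1 ^ 2) :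
    current ψ C κ δ 0 p ≤ C * stress ψ 0 0 p := by
  have h1 := momentum_le_energy (ψ := ψ) (neg_pos.2 ht) (x := p.2 0) (y := p.2 1)
    (by rw [← norm_sq_euc_two]; simpa using hp) p
  have h2 : 0 ≤ κ * weight δ p * -(p.1 * stress ψ 0 0 p + p.2 0 * stress ψ 0 1 p
    + p.2 1 * stress ψ 0 2 p) :=
    mul_nonneg (mul_nonneg hκ (weight_nonneg _ _)) (by linarith)
  unfold current
  linarith

/-- The dominant energy condition gives `-T(∂_t, S) ≤ 2 |t| T_00`, which the `C ∂_t` part absorbs.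
-/
lemma current_zero_nonneg (hκ : 0 ≤ κ) (ht : p.1 < 0) (hp : ‖p.2‖ ^ 2 ≤ p.1 ^ 2)
    (hC : 2 * -p.1 * (κ * weight δ p) ≤ C) : 0 ≤ current ψ C κ δ 0 p := by
  have h1 := momentum_le_energy (ψ := ψ) (neg_pos.2 ht) (x := -p.2 0) (y := -p.2 1)
    (by rw [neg_sq, neg_sq, ← norm_sq_euc_two]; simpa using hp) p
  have h2 := mul_le_mul_of_nonneg_left h1 (mul_nonneg hκ (weight_nonneg δ p))
  have h3 := mul_le_mul_of_nonneg_right hC (stress_zero_zero_nonneg (ψ := ψ) p)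
  unfold current
  linarith

/-- Gives the sign of the flux through the cone, whose normal is `S`: since `T(S, S) ≤ 2t T(S,
∂_t)`, the contraction is at most `(C - 2 |t| κ w) T(S, ∂_t) ≤ 0`. -/
lemma scaling_current_nonpos (hκ : 0 ≤ κ) (ht : p.1 < 0) (hp : ‖p.2‖ ^ 2 ≤ p.1 ^ 2)
    (hC : 2 * -p.1 * (κ * weight δ p) ≤ C) :
    p.1 * current ψ C κ δ 0 p + p.2 0 * current ψ C κ δ 1 p + p.2 1 * current ψ C κ δ 2 p ≤ 0 := by
  have hxy : p.2 0 ^ 2 + p.2 1 ^ 2 ≤ p.1 ^ 2 := by rwa [← norm_sq_euc_two]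
  have h1 := momentum_le_energy (ψ := ψ) (neg_pos.2 ht) (x := p.2 0) (y := p.2 1)
    (by simpa using hxy) p
  have h2 := mul_le_mul_of_nonneg_left (stress_scaling_le (ψ := ψ) hxy p)
    (mul_nonneg hκ (weight_nonneg δ p))
  have h3 := mul_le_mul_of_nonneg_right hC (by linarith : 0 ≤ -(p.1 * stress ψ 0 0 p
    + p.2 0 * stress ψ 0 1 p + p.2 1 * stress ψ 0 2 p))
  unfold current
  rw [stress_symm 1 0, stress_symm 2 0, stress_symm 2 1]
  linarith

/-- In the closed cone the radicand is at least `δ² t²`. This bound dictates `C = 2/δ` for the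
multiplier. -/
lemma neg_mul_weight_le (hδ : 0 < δ) (ht : p.1 < 0) (hp : ‖p.2‖ ^ 2 ≤ p.1 ^ 2) :
    -p.1 * weight δ p ≤ 1 / δ := by
  have h1 : δ * -p.1 ≤ √((1 + δ ^ 2) * p.1 ^ 2 - ‖p.2‖ ^ 2) :=
    Real.le_sqrt_of_sq_le (by nlinarith)
  have h2 : 0 < δ * -p.1 := mul_pos hδ (neg_pos.2 ht)
  rw [weight, ← div_eq_mul_inv, div_le_div_iff₀ (h2.trans_le h1) hδ]
  linarith

lemma one_le_neg_mul_weight (hδ : 0 < δ) (hδ' : δ ≤ 1) (ht : p.1 < 0) (hp : ‖p.2‖ ^ 2 ≤ p.1 ^ 2) :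
    1 ≤ 2 * (-p.1 * weight δ p) := by
  have h0 : 0 < p.1 ^ 2 := sq_pos_of_neg ht
  have h1 : √((1 + δ ^ 2) * p.1 ^ 2 - ‖p.2‖ ^ 2) ≤ 2 * -p.1 := by
    refine Real.sqrt_le_iff.2 ⟨by linarith, ?_⟩
    nlinarith [sq_nonneg ‖p.2‖, mul_le_mul_of_nonneg_right (by nlinarith : δ ^ 2 ≤ 1) h0.le]
  have h2 : 0 < √((1 + δ ^ 2) * p.1 ^ 2 - ‖p.2‖ ^ 2) :=
    Real.sqrt_pos.2 (by nlinarith [mul_pos (pow_pos hδ 2) h0])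
  rw [weight, ← div_eq_mul_inv, ← mul_div_assoc, le_div_iff₀ h2]
  linarith

/-- The scaling component is controlled by the production term and a small multiple of the
energy density. -/
lemma norm_sq_scaling_div_le (hδ : 0 < δ) (hδ' : δ ≤ 1) (ht : p.1 < 0)
    (hp : ‖p.2‖ ^ 2 ≤ p.1 ^ 2) :
    ‖(1 / p.1) • scalingComponent ψ p‖ ^ 2 / -p.1
      ≤ 16 * (production ψ δ p + δ * (stress ψ 0 0 p / -p.1)) := by
  set τ := -p.1 with hτ
  have hτ0 : 0 < τ := neg_pos.2 ht
  set u := τ * weight δ p with hu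
  have hu1 : u ≤ 1 / δ := neg_mul_weight_le hδ ht hp
  have hu2 : 1 ≤ 2 * u := one_le_neg_mul_weight hδ hδ' ht hp
  have hu0 : 0 < u := by linarith
  have hw : weight δ p = u / τ := by rw [hu]; field_simp
  have hnorm : ‖(1 / p.1) • scalingComponent ψ p‖ ^ 2 = ‖scalingComponent ψ p‖ ^ 2 / τ ^ 2 := by
    rw [norm_smul, mul_pow, Real.norm_eq_abs, sq_abs, hτ]; field_simp
  -- Young's inequality, from expanding `|ψ_S - τ δ² ψ_0|² ≥ 0`; half of `|ψ_S|²` is left over.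
  have hcs : -(τ * δ ^ 2 * inner ℝ (ψ 0 p) (scalingComponent ψ p))
      ≥ -(‖scalingComponent ψ p‖ ^ 2 / 2 + δ ^ 4 * τ ^ 2 * inner ℝ (ψ 0 p) (ψ 0 p) / 2) := by
    have h := real_inner_self_nonneg (x := scalingComponent ψ p - (τ * δ ^ 2) • ψ 0 p)
    simp only [inner_sub_left, inner_sub_right, real_inner_smul_left, real_inner_smul_right] at h
    rw [real_inner_self_eq_norm_sq (scalingComponent ψ p),
      real_inner_comm (ψ 0 p) (scalingComponent ψ p)] at h
    linarith
  have he : inner ℝ (ψ 0 p) (ψ 0 p) ≤ 2 * stress ψ 0 0 p := by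
    rw [stress_zero_zero]
    have := real_inner_self_nonneg (x := ψ 1 p)
    have := real_inner_self_nonneg (x := ψ 2 p)
    linarith
  have hprod : production ψ δ p = u ^ 3 / τ ^ 3 * (‖scalingComponent ψ p‖ ^ 2
      - τ * δ ^ 2 * inner ℝ (ψ 0 p) (scalingComponent ψ p)) := by
    rw [production, hw, hτ]; ring
  have h3 : u ^ 3 / τ ^ 3 * (‖scalingComponent ψ p‖ ^ 2 / 2
      - δ ^ 4 * τ ^ 2 * stress ψ 0 0 p) ≤ production ψ δ p := by
    rw [hprod]
    refine mul_le_mul_of_nonneg_left ?_ (by positivity)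
    have := mul_le_mul_of_nonneg_left he (by positivity : 0 ≤ δ ^ 4 * τ ^ 2)
    linarith
  -- The factor `δ⁴` beats the loss `u³ ≤ δ⁻³` near the cone and leaves the small factor `δ` in
  -- front of the energy.
  have h4 : u ^ 3 * δ ^ 4 ≤ δ := by
    have h5 : u * δ ≤ 1 := by rwa [le_div_iff₀ hδ] at hu1
    have h6 : (u * δ) ^ 3 ≤ 1 := pow_le_one₀ (by positivity) h5
    nlinarith
  -- This factor 8, doubled by the half kept in `hcs`, gives the constant 16.
  have h7 : 1 ≤ 8 * u ^ 3 := by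
    have : 1 ≤ (2 * u) ^ 3 := one_le_pow₀ hu2
    linarith
  have h8 : u ^ 3 * δ ^ 4 * (stress ψ 0 0 p / τ) ≤ δ * (stress ψ 0 0 p / τ) :=
    mul_le_mul_of_nonneg_right h4 (div_nonneg (stress_zero_zero_nonneg p) hτ0.le)
  have h9 : 1 * (‖scalingComponent ψ p‖ ^ 2 / τ ^ 3) ≤ 8 * u ^ 3 *
      (‖scalingComponent ψ p‖ ^ 2 / τ ^ 3) := mul_le_mul_of_nonneg_right h7 (by positivity)
  have h10 : u ^ 3 / τ ^ 3 * (‖scalingComponent ψ p‖ ^ 2 / 2 - δ ^ 4 * τ ^ 2 * stress ψ 0 0 p)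
      = u ^ 3 * (‖scalingComponent ψ p‖ ^ 2 / τ ^ 3) / 2
        - u ^ 3 * δ ^ 4 * (stress ψ 0 0 p / τ) := by field_simp
  have h11 : ‖scalingComponent ψ p‖ ^ 2 / τ ^ 2 / τ = ‖scalingComponent ψ p‖ ^ 2 / τ ^ 3 := by
    field_simp
  rw [hnorm, h11]
  linarith

end Pointwise

end

/-! ### Cutoff to the light cone and the energy inequality -/

section

variable {m : ℕ} {ψ : Fin 3 → Spacetime → Euc m} {D : Fin 3 → Fin 3 → Spacetime → Euc m}

/-- A smooth approximation, from below, of the indicator function of the light cone. -/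
def cutoff (n : ℝ) (p : Spacetime) : ℝ := Real.smoothTransition (n * (p.1 ^ 2 - ‖p.2‖ ^ 2))

/-- The profile of the gradient of `cutoff n`, which is `cutoffDeriv n p * (t, -x)`. -/
def cutoffDeriv (n : ℝ) (p : Spacetime) : ℝ :=
  2 * n * deriv Real.smoothTransition (n * (p.1 ^ 2 - ‖p.2‖ ^ 2))

section Cutoff

variable {n : ℝ} {p : Spacetime}

lemma cutoff_nonneg : 0 ≤ cutoff n p := Real.smoothTransition.nonneg _

lemma cutoff_le_one : cutoff n p ≤ 1 := Real.smoothTransition.le_one _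

lemma cutoff_eq_zero (hn : 0 < n) (hp : p.1 ^ 2 ≤ ‖p.2‖ ^ 2) : cutoff n p = 0 :=
  Real.smoothTransition.zero_of_nonpos (mul_nonpos_of_nonneg_of_nonpos hn.le (by linarith))

lemma cutoffDeriv_nonneg (hn : 0 < n) : 0 ≤ cutoffDeriv n p :=
  mul_nonneg (by linarith) Real.smoothTransition.monotone.deriv_nonneg

lemma cutoffDeriv_eq_zero (hn : 0 < n) (hp : p.1 ^ 2 < ‖p.2‖ ^ 2) : cutoffDeriv n p = 0 := by
  have h : Real.smoothTransition =ᶠ[𝓝 (n * (p.1 ^ 2 - ‖p.2‖ ^ 2))] fun _ => 0 := by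
    filter_upwards [Iio_mem_nhds (mul_neg_of_pos_of_neg hn (by linarith))] with s hs
    exact Real.smoothTransition.zero_of_nonpos (le_of_lt hs)
  rw [cutoffDeriv, h.deriv_eq]; simp

lemma contDiff_quadratic {k : WithTop ℕ∞} (n : ℝ) :
    ContDiff ℝ k fun p : Spacetime => n * (p.1 ^ 2 - ‖p.2‖ ^ 2) :=
  contDiff_const.mul ((contDiff_fst.pow 2).sub (contDiff_snd.norm_sq ℝ))

lemma contDiff_cutoff (n : ℝ) : ContDiff ℝ 1 (cutoff n) :=
  (Real.smoothTransition.contDiff (n := 1)).comp (contDiff_quadratic n)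

lemma continuous_cutoffDeriv (n : ℝ) : Continuous (cutoffDeriv n) :=
  continuous_const.mul (((Real.smoothTransition.contDiff (n := 1)).continuous_deriv (by simp)).comp
    (contDiff_quadratic (k := 0) n).continuous)

/-- Raising the index turns this gradient into `-cutoffDeriv n` times `S`, so the cutoff error is a
contraction of the current with `S`. -/
lemma fderiv_cutoff (n : ℝ) (p : Spacetime) (α : Fin 3) :
    fderiv ℝ (cutoff n) p (coordVec α) = cutoffDeriv n p * ![p.1, -p.2 0, -p.2 1] α := by
  set f : Spacetime → ℝ := fun p => n * (p.1 ^ 2 - (p.2 0 ^ 2 + p.2 1 ^ 2)) with hf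
  have hcf : cutoff n = fun p => Real.smoothTransition (f p) := by
    funext p; simp only [cutoff, hf, norm_sq_euc_two]
  have hfd : HasDerivAt (fun r : ℝ => f (p + r • coordVec α))
      (2 * n * ![p.1, -p.2 0, -p.2 1] α) 0 := by
    have hl : ∀ a b : ℝ, HasDerivAt (fun r : ℝ => (a + r * b) ^ 2) (2 * a * b) 0 := by
      intro a b
      exact (((hasDerivAt_id (0 : ℝ)).mul_const b).const_add a |>.pow 2).congr_deriv (by simp)
    have := ((hl p.1 (coordVec α).1).sub
      ((hl (p.2 0) ((coordVec α).2 0)).add (hl (p.2 1) ((coordVec α).2 1)))).const_mul n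
    simp only [hf]
    convert! this using 1
    fin_cases α <;> simp [coordVec] <;> ring
  have hp0 : f (p + (0 : ℝ) • coordVec α) = f p := by simp
  have hg : HasDerivAt Real.smoothTransition (deriv Real.smoothTransition (f p))
      (f (p + (0 : ℝ) • coordVec α)) := by
    rw [hp0]
    exact ((Real.smoothTransition.contDiff (n := 1)).differentiable (by simp) _).hasDerivAt
  have h1 : HasLineDerivAt ℝ (cutoff n) (deriv Real.smoothTransition (f p) *
      (2 * n * ![p.1, -p.2 0, -p.2 1] α)) p (coordVec α) := by
    rw [hcf]; exact hg.comp (0 : ℝ) hfd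
  have h2 := ((contDiff_cutoff n).differentiable (by simp) p).hasFDerivAt.hasLineDerivAt
    (coordVec α)
  rw [h2.unique h1, cutoffDeriv, norm_sq_euc_two]
  ring

end Cutoff

section Gluing

variable {δ : ℝ} {f q : Spacetime → ℝ}

lemma eventually_outside {p : Spacetime} (hp : p.1 ^ 2 < ‖p.2‖ ^ 2) :
    ∀ᶠ p' : Spacetime in 𝓝 p, p'.1 ^ 2 < ‖p'.2‖ ^ 2 :=
  (isOpen_lt (by fun_prop) (by fun_prop)).mem_nhds hp

lemma norm_sq_lt_of_le (hδ : 0 < δ) {p : Spacetime} (ht : p.1 < 0) (hp : ‖p.2‖ ^ 2 ≤ p.1 ^ 2) :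
    ‖p.2‖ ^ 2 < (1 + δ ^ 2) * p.1 ^ 2 := by
  nlinarith [mul_pos (pow_pos hδ 2) (sq_pos_of_neg ht)]

/-- The factor `q` is only controlled in the wider cone `|x|² < (1 + δ²) t²`. That open set contains
the closed light cone within the slab, and outside the light cone the product vanishes locally. -/
lemma continuousOn_mul_of_cone (hδ : 0 < δ) (hf : Continuous f)
    (hf0 : ∀ p : Spacetime, p.1 ^ 2 < ‖p.2‖ ^ 2 → f p = 0)
    (hq : ContinuousOn q (slab ∩ {p | ‖p.2‖ ^ 2 < (1 + δ ^ 2) * p.1 ^ 2})) :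
    ContinuousOn (fun p => f p * q p) slab := by
  intro p hp
  rcases lt_or_ge (p.1 ^ 2) (‖p.2‖ ^ 2) with h | h
  · have : (fun p => f p * q p) =ᶠ[𝓝 p] fun _ => 0 := by
      filter_upwards [eventually_outside h] with p' hp'
      rw [hf0 p' hp', zero_mul]
    exact (continuousAt_const.congr this.symm).continuousWithinAt
  · have hlt := norm_sq_lt_of_le hδ hp.1.2 h
    have ho : IsOpen {p : Spacetime | ‖p.2‖ ^ 2 < (1 + δ ^ 2) * p.1 ^ 2} :=
      isOpen_lt (by fun_prop) (by fun_prop)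
    exact hf.continuousWithinAt.mul
      ((hq p ⟨hp, hlt⟩).mono_of_mem_nhdsWithin (inter_mem_nhdsWithin _ (ho.mem_nhds hlt)))

lemma contDiffAt_mul_of_cone (hδ : 0 < δ) (hf : ContDiff ℝ 1 f)
    (hf0 : ∀ p : Spacetime, p.1 ^ 2 < ‖p.2‖ ^ 2 → f p = 0) {p : Spacetime} (hp : slab ∈ 𝓝 p)
    (hq : ‖p.2‖ ^ 2 < (1 + δ ^ 2) * p.1 ^ 2 → ContDiffAt ℝ 1 q p) :
    ContDiffAt ℝ 1 (fun p => f p * q p) p := by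
  rcases lt_or_ge (p.1 ^ 2) (‖p.2‖ ^ 2) with h | h
  · have : (fun p => f p * q p) =ᶠ[𝓝 p] fun _ => 0 := by
      filter_upwards [eventually_outside h] with p' hp'
      rw [hf0 p' hp', zero_mul]
    exact contDiffAt_const.congr_of_eventuallyEq this
  · exact hf.contDiffAt.mul (hq (norm_sq_lt_of_le hδ (mem_of_mem_nhds hp).1.2 h))

end Gluing

section Regularity

variable {δ : ℝ}

lemma contDiffOn_weight (δ : ℝ) :
    ContDiffOn ℝ ∞ (weight δ) {p | ‖p.2‖ ^ 2 < (1 + δ ^ 2) * p.1 ^ 2} := by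
  have h : ContDiff ℝ ∞ fun p : Spacetime => (1 + δ ^ 2) * p.1 ^ 2 - ‖p.2‖ ^ 2 :=
    (contDiff_const.mul (contDiff_fst.pow 2)).sub (contDiff_snd.norm_sq ℝ)
  refine (h.contDiffOn.sqrt fun p hp => ?_).inv fun p hp => ?_
  · exact (sub_pos.2 hp).ne'
  · exact (Real.sqrt_pos.2 (sub_pos.2 hp)).ne'

lemma contDiff_coord (j : Fin 2) : ContDiff ℝ ∞ fun p : Spacetime => p.2 j :=
  (EuclideanSpace.proj j : Euc 2 →L[ℝ] ℝ).contDiff.comp contDiff_snd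

lemma contDiffOn_current (hψ : ∀ α, ContDiffOn ℝ ∞ (ψ α) slab) (C κ δ : ℝ) (α : Fin 3) :
    ContDiffOn ℝ ∞ (current ψ C κ δ α) (slab ∩ {p | ‖p.2‖ ^ 2 < (1 + δ ^ 2) * p.1 ^ 2}) := by
  have hs := fun β => (contDiffOn_stress hψ α β).mono
    (inter_subset_left (t := {p | ‖p.2‖ ^ 2 < (1 + δ ^ 2) * p.1 ^ 2}))
  have hw := (contDiffOn_weight δ).mono (inter_subset_right (s := slab))
  exact (contDiffOn_const.mul (hs 0)).add ((contDiffOn_const.mul hw).mul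
    (((contDiff_fst.contDiffOn.mul (hs 0)).add ((contDiff_coord 0).contDiffOn.mul (hs 1))).add
      ((contDiff_coord 1).contDiffOn.mul (hs 2))))

lemma contDiffOn_scalingComponent (hψ : ∀ α, ContDiffOn ℝ ∞ (ψ α) slab) :
    ContDiffOn ℝ ∞ (scalingComponent ψ) slab :=
  ((contDiff_fst.contDiffOn.smul (hψ 0)).add ((contDiff_coord 0).contDiffOn.smul (hψ 1))).add
    ((contDiff_coord 1).contDiffOn.smul (hψ 2))

lemma continuousOn_production (hψ : ∀ α, ContDiffOn ℝ ∞ (ψ α) slab) (δ : ℝ) :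
    ContinuousOn (production ψ δ) (slab ∩ {p | ‖p.2‖ ^ 2 < (1 + δ ^ 2) * p.1 ^ 2}) := by
  have hS := (contDiffOn_scalingComponent hψ).continuousOn.mono
    (inter_subset_left (t := {p | ‖p.2‖ ^ 2 < (1 + δ ^ 2) * p.1 ^ 2}))
  have h0 := (hψ 0).continuousOn.mono
    (inter_subset_left (t := {p | ‖p.2‖ ^ 2 < (1 + δ ^ 2) * p.1 ^ 2}))
  have hw := (contDiffOn_weight δ).continuousOn.mono (inter_subset_right (s := slab))
  exact (hw.pow 3).mul ((hS.norm.pow 2).add (continuousOn_const.mul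
    (continuous_fst.continuousOn.mul (h0.inner hS))))

end Regularity

/-- As `|t| ≤ 1` on the slab, anything supported in the cone is supported in `|x| ≤ 1`. -/
lemma sq_lt_norm_sq_of_slab {p : Spacetime} (hp : p ∈ slab) (h : 1 < ‖p.2‖) :
    p.1 ^ 2 < ‖p.2‖ ^ 2 := by
  have h1 := hp.1.1
  have h2 := hp.1.2
  nlinarith

/-- The energy inequality for a causal multiplier on the light cone. -/
theorem integral_cutoff_production_le (hψ : SatisfiesGaugeIdentities ψ D) {C κ δ n T : ℝ}
    (hδ : 0 < δ) (hn : 0 < n) (hκ : 0 ≤ κ)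
    (hC : ∀ p : Spacetime, p.1 < 0 → ‖p.2‖ ^ 2 ≤ p.1 ^ 2 → 2 * -p.1 * (κ * weight δ p) ≤ C)
    (hT : T ∈ Ioo (-1 : ℝ) 0) :
    ∫ t in (-1 : ℝ)..T, ∫ x : Euc 2, cutoff n (t, x) * (κ * production ψ δ (t, x))
      ≤ (∫ x : Euc 2, cutoff n (-1, x) * current ψ C κ δ 0 (-1, x))
        - ∫ x : Euc 2, cutoff n (T, x) * current ψ C κ δ 0 (T, x) := by
  have hχ0 : ∀ p : Spacetime, p.1 ^ 2 < ‖p.2‖ ^ 2 → cutoff n p = 0 := fun p hp =>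
    cutoff_eq_zero hn hp.le
  have hχ0' : ∀ p : Spacetime, p.1 ^ 2 < ‖p.2‖ ^ 2 → cutoffDeriv n p = 0 := fun p hp =>
    cutoffDeriv_eq_zero hn hp
  have hQ := contDiffOn_current hψ.contDiffOn C κ δ
  set F : Spacetime → ℝ := fun p => p.1 * current ψ C κ δ 0 p + p.2 0 * current ψ C κ δ 1 p
    + p.2 1 * current ψ C κ δ 2 p with hF
  have hFc : ContinuousOn F (slab ∩ {p | ‖p.2‖ ^ 2 < (1 + δ ^ 2) * p.1 ^ 2}) :=
    ((continuous_fst.continuousOn.mul (hQ 0).continuousOn).add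
      ((contDiff_coord 0).continuous.continuousOn.mul (hQ 1).continuousOn)).add
      ((contDiff_coord 1).continuous.continuousOn.mul (hQ 2).continuousOn)
  have hRD : ContinuousOn (fun p => cutoff n p * (κ * production ψ δ p)) slab :=
    continuousOn_mul_of_cone hδ (contDiff_cutoff n).continuous hχ0
      (continuousOn_const.mul (continuousOn_production hψ.contDiffOn δ))
  have hRF : ContinuousOn (fun p => cutoffDeriv n p * F p) slab :=
    continuousOn_mul_of_cone hδ (continuous_cutoffDeriv n) hχ0' hFc
  have hRD0 : ∀ p ∈ slab, 1 < ‖p.2‖ → cutoff n p * (κ * production ψ δ p) = 0 := fun p hp h => by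
    rw [hχ0 p (sq_lt_norm_sq_of_slab hp h), zero_mul]
  have hR : ContinuousOn
      (fun p => cutoff n p * (κ * production ψ δ p) - cutoffDeriv n p * F p) slab := hRD.sub hRF
  have hR0 : ∀ p ∈ slab, 1 < ‖p.2‖ →
      cutoff n p * (κ * production ψ δ p) - cutoffDeriv n p * F p = 0 := fun p hp h => by
    rw [hRD0 p hp h, hχ0' p (sq_lt_norm_sq_of_slab hp h), zero_mul, sub_zero]
  have ho : IsOpen {p : Spacetime | ‖p.2‖ ^ 2 < (1 + δ ^ 2) * p.1 ^ 2} :=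
    isOpen_lt (by fun_prop) (by fun_prop)
  have hQat : ∀ α p, slab ∈ 𝓝 p → ‖p.2‖ ^ 2 < (1 + δ ^ 2) * p.1 ^ 2 →
      ContDiffAt ℝ ∞ (current ψ C κ δ α) p := fun α p hp h =>
    (hQ α).contDiffAt (inter_mem hp (ho.mem_nhds h))
  -- The source is the cutoff production term minus `cutoffDeriv n * F`; since `F ≤ 0` in the cone,
  -- dropping the second term only decreases the integral.
  have hid := integral_divergence_slab (P := fun α p => cutoff n p * current ψ C κ δ α p)
    (R := fun p => cutoff n p * (κ * production ψ δ p) - cutoffDeriv n p * F p)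
    (continuousOn_mul_of_cone hδ (contDiff_cutoff n).continuous hχ0 (hQ 0).continuousOn)
    (fun α p hp => contDiffAt_mul_of_cone hδ (contDiff_cutoff n) hχ0 hp
      fun h => (hQat α p hp h).of_le (by norm_cast))
    (fun α p hp h => by rw [hχ0 p (sq_lt_norm_sq_of_slab hp h), zero_mul]) hR hR0 ?_ hT
  · rw [← hid]
    refine intervalIntegral.integral_mono_on hT.1.le
      ((continuousOn_integral_slice hRD hRD0 hT.2).intervalIntegrable_of_Icc hT.1.le)
      ((continuousOn_integral_slice hR hR0 hT.2).intervalIntegrable_of_Icc hT.1.le) fun t ht => ?_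
    have ht' : t ∈ Ico (-1 : ℝ) 0 := ⟨ht.1, ht.2.trans_lt hT.2⟩
    refine integral_mono (integrable_slab_slice hRD hRD0 ht')
      (integrable_slab_slice hR hR0 ht') fun x => ?_
    simp only
    rcases lt_or_ge (t ^ 2) (‖x‖ ^ 2) with h | h
    · rw [hχ0' (t, x) h]; simp
    · have := mul_nonpos_of_nonneg_of_nonpos (cutoffDeriv_nonneg (p := (t, x)) hn)
        (scaling_current_nonpos (ψ := ψ) (p := (t, x)) hκ ht'.2 h (hC (t, x) ht'.2 h))
      simp only [hF]
      linarith
  · intro p hp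
    rcases lt_or_ge (p.1 ^ 2) (‖p.2‖ ^ 2) with h | h
    · have hz : ∀ α, (fun p => cutoff n p * current ψ C κ δ α p) =ᶠ[𝓝 p] fun _ => 0 := by
        intro α
        filter_upwards [eventually_outside h] with p' hp'
        rw [hχ0 p' hp', zero_mul]
      simp only [(hz _).fderiv_eq, hχ0 p h, hχ0' p h]
      simp
    · have hlt := norm_sq_lt_of_le hδ (mem_of_mem_nhds hp).1.2 h
      have hd := fun α => (hQat α p hp hlt).differentiableAt (by simp)
      have hχd := (contDiff_cutoff n).differentiable (by simp) p
      have hdiv := divergence_current hψ hp hlt C κ hd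
      have hprod : ∀ α, fderiv ℝ (fun p => cutoff n p * current ψ C κ δ α p) p (coordVec α)
          = cutoff n p * fderiv ℝ (current ψ C κ δ α) p (coordVec α)
            + current ψ C κ δ α p * (cutoffDeriv n p * ![p.1, -p.2 0, -p.2 1] α) := by
        intro α
        rw [fderiv_fun_mul hχd (hd α), ← fderiv_cutoff]
        simp
      simp only [hprod, hF]
      simp only [Fin.sum_univ_three] at hdiv ⊢
      simp [minkowski] at hdiv ⊢
      linear_combination cutoff n p * hdiv

end

/-! ### Integrated estimates, removal of the cutoff and the choice of `δ` -/

section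

variable {m : ℕ} {ψ : Fin 3 → Spacetime → Euc m} {D : Fin 3 → Fin 3 → Spacetime → Euc m}

/-- The initial energy in the light cone. -/
def coneEnergy (ψ : Fin 3 → Spacetime → Euc m) : ℝ :=
  ∫ x in Metric.closedBall (0 : Euc 2) 1, stress ψ 0 0 (-1, x)

/-- The density `|t|⁻¹ |ψ_S / t|²`. -/
def scalingDensity (ψ : Fin 3 → Spacetime → Euc m) (p : Spacetime) : ℝ :=
  ‖(1 / p.1) • scalingComponent ψ p‖ ^ 2 / -p.1

lemma continuousOn_scalingDensity (hψ : ∀ α, ContDiffOn ℝ ∞ (ψ α) slab) :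
    ContinuousOn (scalingDensity ψ) slab := by
  have hS := (contDiffOn_scalingComponent hψ).continuousOn
  have h0 : ∀ p ∈ slab, p.1 ≠ 0 := fun p hp => hp.1.2.ne
  exact (((continuousOn_const.div continuous_fst.continuousOn h0).smul hS).norm.pow 2).div
    continuous_fst.continuousOn.neg fun p hp => neg_ne_zero.2 (h0 p hp)

section CutoffIntegrals

variable {n : ℝ} {f : Spacetime → ℝ}

lemma continuousOn_cutoff_mul (hf : ContinuousOn f slab) :
    ContinuousOn (fun p => cutoff n p * f p) slab :=
  (contDiff_cutoff n).continuous.continuousOn.mul hf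

lemma cutoff_mul_eq_zero (hn : 0 < n) : ∀ p ∈ slab, 1 < ‖p.2‖ → cutoff n p * f p = 0 :=
  fun p hp h => by rw [cutoff_eq_zero hn (sq_lt_norm_sq_of_slab hp h).le, zero_mul]

lemma integral_cutoff_initial_le (hψ : ∀ α, ContDiffOn ℝ ∞ (ψ α) slab) (hn : 0 < n) :
    ∫ x : Euc 2, cutoff n (-1, x) * stress ψ 0 0 (-1, x) ≤ coneEnergy ψ := by
  have hmem : (-1 : ℝ) ∈ Ico (-1 : ℝ) 0 := by norm_num
  have hc := (contDiffOn_stress hψ 0 0).continuousOn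
  rw [coneEnergy, ← integral_indicator measurableSet_closedBall]
  refine integral_mono (integrable_slab_slice (continuousOn_cutoff_mul hc)
    (cutoff_mul_eq_zero hn) hmem) ?_ fun x => ?_
  · exact (integrable_indicator_iff measurableSet_closedBall).2
      ((continuousOn_slab_slice hc hmem).continuousOn.integrableOn_compact
        (isCompact_closedBall _ _))
  · by_cases hx : x ∈ Metric.closedBall (0 : Euc 2) 1
    · simp only [indicator_of_mem hx]
      exact mul_le_of_le_one_left (stress_zero_zero_nonneg _) cutoff_le_one
    · simp only [indicator_of_notMem hx]
      exact (cutoff_mul_eq_zero hn (f := stress ψ 0 0) (-1, x) ⟨hmem, mem_univ _⟩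
        (by simpa using hx)).le

/-- The localized energy does not exceed the initial energy in the cone. -/
lemma integral_cutoff_energy_le (hψ : SatisfiesGaugeIdentities ψ D) (hn : 0 < n) {t : ℝ}
    (ht : t ∈ Ico (-1 : ℝ) 0) :
    ∫ x : Euc 2, cutoff n (t, x) * stress ψ 0 0 (t, x) ≤ coneEnergy ψ := by
  rcases ht.1.eq_or_lt with h | h
  · rw [← h]; exact integral_cutoff_initial_le hψ.contDiffOn hn
  -- With `κ = 0` the multiplier is `∂_t` and the production term disappears; the value of `δ` is
  -- immaterial.
  · have := integral_cutoff_production_le hψ (C := 1) (κ := 0) one_pos hn le_rfl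
      (fun p _ _ => by simp) (T := t) ⟨h, ht.2⟩
    simp only [zero_mul, mul_zero, integral_zero, intervalIntegral.integral_zero, current, one_mul,
      add_zero] at this
    linarith [integral_cutoff_initial_le hψ.contDiffOn hn]

/-- Uses `κ = 1` and `C = 2/δ`. The term at time `T` is nonnegative and is discarded, and the one at
time `-1` is at most `C` times the energy. -/
lemma integral_cutoff_production_le_coneEnergy (hψ : SatisfiesGaugeIdentities ψ D) {δ T : ℝ}
    (hδ : 0 < δ) (hn : 0 < n) (hT : T ∈ Ioo (-1 : ℝ) 0) :
    ∫ t in (-1 : ℝ)..T, ∫ x : Euc 2, cutoff n (t, x) * production ψ δ (t, x)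
      ≤ 2 / δ * coneEnergy ψ := by
  have hC : ∀ p : Spacetime, p.1 < 0 → ‖p.2‖ ^ 2 ≤ p.1 ^ 2 →
      2 * -p.1 * (1 * weight δ p) ≤ 2 / δ := fun p ht hp => by
    have := neg_mul_weight_le hδ ht hp
    have h2 : 2 / δ = 2 * (1 / δ) := by ring
    rw [h2]; linarith
  have h1 := integral_cutoff_production_le hψ hδ hn zero_le_one hC hT
  simp only [one_mul] at h1
  have hT' : T ∈ Ico (-1 : ℝ) 0 := Ioo_subset_Ico_self hT
  have hmem : (-1 : ℝ) ∈ Ico (-1 : ℝ) 0 := by norm_num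
  have h2 : 0 ≤ ∫ x : Euc 2, cutoff n (T, x) * current ψ (2 / δ) 1 δ 0 (T, x) := by
    refine integral_nonneg fun x => ?_
    rcases lt_or_ge (T ^ 2) (‖x‖ ^ 2) with h | h
    · simp [cutoff_eq_zero (p := (T, x)) hn h.le]
    · exact mul_nonneg cutoff_nonneg
        (current_zero_nonneg zero_le_one hT.2 h (hC (T, x) hT.2 h))
  have h3 : ∫ x : Euc 2, cutoff n (-1, x) * current ψ (2 / δ) 1 δ 0 (-1, x)
      ≤ 2 / δ * ∫ x : Euc 2, cutoff n (-1, x) * stress ψ 0 0 (-1, x) := by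
    rw [← integral_const_mul]
    refine integral_mono (integrable_slab_slice (continuousOn_mul_of_cone hδ
      (contDiff_cutoff n).continuous (fun p hp => cutoff_eq_zero hn hp.le)
      (contDiffOn_current hψ.contDiffOn _ _ _ 0).continuousOn) (cutoff_mul_eq_zero hn) hmem)
      ((integrable_slab_slice (continuousOn_cutoff_mul
        (contDiffOn_stress hψ.contDiffOn 0 0).continuousOn)
        (cutoff_mul_eq_zero hn) hmem).const_mul _) fun x => ?_
    simp only
    rcases lt_or_ge ((-1 : ℝ) ^ 2) (‖x‖ ^ 2) with h | h
    · simp [cutoff_eq_zero (p := (-1, x)) hn h.le]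
    · have := mul_le_mul_of_nonneg_left (current_zero_le (ψ := ψ) (C := 2 / δ) (δ := δ)
        (p := (-1, x)) zero_le_one (by norm_num) h) (cutoff_nonneg (n := n) (p := (-1, x)))
      linarith
  have h4 := mul_le_mul_of_nonneg_left (integral_cutoff_initial_le hψ.contDiffOn hn)
    (by positivity : 0 ≤ 2 / δ)
  linarith

/-- The energy bound at each time is integrated against `dt/|t|`, whose mass on `[-1, T]` is
`|log|T||`. -/
lemma integral_cutoff_energy_div_le (hψ : SatisfiesGaugeIdentities ψ D) {T : ℝ}
    (hn : 0 < n) (hT : T ∈ Ioo (-1 : ℝ) 0) :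
    ∫ t in (-1 : ℝ)..T, ∫ x : Euc 2, cutoff n (t, x) * (stress ψ 0 0 (t, x) / -t)
      ≤ coneEnergy ψ * |Real.log (|T|)| := by
  have hlog : ∫ t in (-1 : ℝ)..T, coneEnergy ψ * (-t⁻¹) = coneEnergy ψ * |Real.log (|T|)| := by
    rw [intervalIntegral.integral_const_mul, intervalIntegral.integral_neg,
      integral_inv_of_neg (by norm_num) hT.2]
    have h1 : |T| = -T := abs_of_neg hT.2
    have h2 : Real.log (-T) < 0 := Real.log_neg (by linarith [hT.2]) (by linarith [hT.1])
    rw [h1, abs_of_neg h2]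
    congr 3
    ring
  rw [← hlog]
  have hsub : ∀ t ∈ Icc (-1 : ℝ) T, t ∈ Ico (-1 : ℝ) 0 := fun t ht => ⟨ht.1, ht.2.trans_lt hT.2⟩
  have hc : ContinuousOn (fun p : Spacetime => stress ψ 0 0 p / -p.1) slab :=
    (contDiffOn_stress hψ.contDiffOn 0 0).continuousOn.div continuous_fst.continuousOn.neg
      fun p hp => neg_ne_zero.2 hp.1.2.ne
  refine intervalIntegral.integral_mono_on hT.1.le
    ((continuousOn_integral_slice (continuousOn_cutoff_mul hc) (cutoff_mul_eq_zero hn)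
      hT.2).intervalIntegrable_of_Icc hT.1.le) ?_ fun t ht => ?_
  · refine ContinuousOn.intervalIntegrable_of_Icc hT.1.le ?_
    exact continuousOn_const.mul (continuousOn_id.inv₀ fun t ht => (hsub t ht).2.ne).neg
  · have h1 : ∀ x : Euc 2, cutoff n (t, x) * (stress ψ 0 0 (t, x) / -t)
        = -t⁻¹ * (cutoff n (t, x) * stress ψ 0 0 (t, x)) := by
      intro x
      have := (hsub t ht).2.ne
      field_simp
    simp only [h1]
    rw [integral_const_mul, mul_comm]
    exact mul_le_mul_of_nonneg_right (integral_cutoff_energy_le hψ hn (hsub t ht))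
      (neg_nonneg.2 (inv_nonpos.2 (hsub t ht).2.le))

lemma integral_cutoff_scalingDensity_le (hψ : SatisfiesGaugeIdentities ψ D) {δ T : ℝ}
    (hδ : 0 < δ) (hδ' : δ ≤ 1) (hn : 0 < n) (hT : T ∈ Ioo (-1 : ℝ) 0) :
    ∫ t in (-1 : ℝ)..T, ∫ x : Euc 2, cutoff n (t, x) * scalingDensity ψ (t, x)
      ≤ 16 * coneEnergy ψ * (2 / δ + δ * |Real.log (|T|)|) := by
  have hsub : ∀ t ∈ Icc (-1 : ℝ) T, t ∈ Ico (-1 : ℝ) 0 := fun t ht => ⟨ht.1, ht.2.trans_lt hT.2⟩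
  have hχ0 : ∀ p : Spacetime, p.1 ^ 2 < ‖p.2‖ ^ 2 → cutoff n p = 0 := fun p hp =>
    cutoff_eq_zero hn hp.le
  have hcF := continuousOn_cutoff_mul (n := n) (continuousOn_scalingDensity hψ.contDiffOn)
  have hcP : ContinuousOn (fun p => cutoff n p * production ψ δ p) slab :=
    continuousOn_mul_of_cone hδ (contDiff_cutoff n).continuous hχ0
      (continuousOn_production hψ.contDiffOn δ)
  have hcE : ContinuousOn (fun p : Spacetime => cutoff n p * (stress ψ 0 0 p / -p.1)) slab :=
    continuousOn_cutoff_mul ((contDiffOn_stress hψ.contDiffOn 0 0).continuousOn.div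
      continuous_fst.continuousOn.neg fun p hp => neg_ne_zero.2 hp.1.2.ne)
  have iF := (continuousOn_integral_slice hcF (cutoff_mul_eq_zero hn)
      hT.2).intervalIntegrable_of_Icc (μ := volume) hT.1.le
  have iP := (continuousOn_integral_slice hcP (cutoff_mul_eq_zero hn)
      hT.2).intervalIntegrable_of_Icc (μ := volume) hT.1.le
  have iE := (continuousOn_integral_slice hcE (cutoff_mul_eq_zero hn)
      hT.2).intervalIntegrable_of_Icc (μ := volume) hT.1.le
  have hmain : ∫ t in (-1 : ℝ)..T, ∫ x : Euc 2, cutoff n (t, x) * scalingDensity ψ (t, x)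
      ≤ ∫ t in (-1 : ℝ)..T, 16 * ((∫ x : Euc 2, cutoff n (t, x) * production ψ δ (t, x))
        + δ * ∫ x : Euc 2, cutoff n (t, x) * (stress ψ 0 0 (t, x) / -t)) := by
    refine intervalIntegral.integral_mono_on hT.1.le iF ((iP.add (iE.const_mul δ)).const_mul 16)
      fun t ht => ?_
    have ht' := hsub t ht
    have jP := integrable_slab_slice hcP (cutoff_mul_eq_zero hn) ht'
    have jE := integrable_slab_slice hcE (cutoff_mul_eq_zero hn) ht'
    rw [← integral_const_mul, ← integral_add jP (jE.const_mul δ), ← integral_const_mul]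
    refine integral_mono (integrable_slab_slice hcF (cutoff_mul_eq_zero hn) ht')
      ((jP.add (jE.const_mul δ)).const_mul 16) fun x => ?_
    simp only
    rcases lt_or_ge (t ^ 2) (‖x‖ ^ 2) with h | h
    · simp [hχ0 (t, x) h]
    · have := mul_le_mul_of_nonneg_left (norm_sq_scaling_div_le (ψ := ψ) (p := (t, x))
        hδ hδ' ht'.2 h) (cutoff_nonneg (n := n) (p := (t, x)))
      simp only [scalingDensity]
      simp only at this
      linarith
  refine hmain.trans ?_
  rw [intervalIntegral.integral_const_mul, intervalIntegral.integral_add iP (iE.const_mul δ),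
    intervalIntegral.integral_const_mul]
  have h1 := integral_cutoff_production_le_coneEnergy hψ hδ hn hT
  have h2 := mul_le_mul_of_nonneg_left (integral_cutoff_energy_div_le hψ hn hT) hδ.le
  linarith

end CutoffIntegrals

/-- The cutoffs converge to the indicator function of the open cone. -/
lemma tendsto_cutoff (p : Spacetime) :
    Tendsto (fun k : ℕ => cutoff (k + 1) p) atTop
      (𝓝 ({p : Spacetime | ‖p.2‖ < |p.1|}.indicator (fun _ => 1) p)) := by
  by_cases h : ‖p.2‖ < |p.1|
  · rw [indicator_of_mem (show p ∈ {p : Spacetime | ‖p.2‖ < |p.1|} from h)]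
    have hlt : 0 < p.1 ^ 2 - ‖p.2‖ ^ 2 := by
      rw [← sq_abs p.1]; nlinarith [norm_nonneg p.2]
    refine tendsto_const_nhds.congr' ?_
    have h1 : Tendsto (fun k : ℕ => ((k : ℝ) + 1) * (p.1 ^ 2 - ‖p.2‖ ^ 2)) atTop atTop :=
      (tendsto_natCast_atTop_atTop.atTop_add tendsto_const_nhds).atTop_mul_const hlt
    filter_upwards [h1.eventually_ge_atTop 1] with k hk
    exact (Real.smoothTransition.one_of_one_le hk).symm
  · rw [indicator_of_notMem (show p ∉ {p : Spacetime | ‖p.2‖ < |p.1|} from h)]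
    refine tendsto_const_nhds.congr fun k => ?_
    rw [cutoff_eq_zero (by positivity)]
    rw [← sq_abs p.1]
    -- The cutoff also vanishes on `|x| = |t|`, so the limit is the indicator of the open cone.
    exact pow_le_pow_left₀ (abs_nonneg _) (not_lt.1 h) 2

lemma exists_bound_on_cylinder {f : Spacetime → ℝ} (hf : ContinuousOn f slab) {T : ℝ}
    (hT : T < 0) : ∃ M : ℝ, 0 ≤ M ∧ ∀ t ∈ Icc (-1) T, ∀ x ∈ Metric.closedBall (0 : Euc 2) 1,
      |f (t, x)| ≤ M := by
  obtain ⟨M, hM⟩ := (isCompact_Icc.prod (isCompact_closedBall (0 : Euc 2) 1)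
    ).exists_bound_of_continuousOn (hf.mono fun p (hp : p ∈ Icc (-1) T ×ˢ _) =>
      (⟨⟨hp.1.1, hp.1.2.trans_lt hT⟩, mem_univ _⟩ : p ∈ slab))
  exact ⟨max M 0, le_max_right _ _, fun t ht x hx => (hM (t, x) ⟨ht, hx⟩).trans (le_max_left _ _)⟩

/-- The integrals against the cutoffs converge to the integral over the truncated cone. -/
lemma tendsto_integral_cutoff {f : Spacetime → ℝ} (hf : ContinuousOn f slab) {T : ℝ}
    (hT : T ∈ Ioo (-1 : ℝ) 0) :
    Tendsto (fun k : ℕ => ∫ t in (-1 : ℝ)..T, ∫ x : Euc 2, cutoff (k + 1) (t, x) * f (t, x)) atTop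
      (𝓝 (∫ t in (-1 : ℝ)..T, ∫ x in Metric.ball (0 : Euc 2) |t|, f (t, x))) := by
  obtain ⟨M, hM0, hM⟩ := exists_bound_on_cylinder hf hT.2
  have hsub : ∀ t ∈ Icc (-1 : ℝ) T, t ∈ Ico (-1 : ℝ) 0 := fun t ht => ⟨ht.1, ht.2.trans_lt hT.2⟩
  have hk : ∀ k : ℕ, (0 : ℝ) < k + 1 := fun k => by positivity
  have hι : ∀ t ∈ uIoc (-1) T, t ∈ Icc (-1) T := fun t ht => by
    rw [uIoc_of_le hT.1.le] at ht; exact Ioc_subset_Icc_self ht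
  have hbi : Integrable ((Metric.closedBall (0 : Euc 2) 1).indicator fun _ => M) :=
    (integrable_indicator_iff measurableSet_closedBall).2
      (integrableOn_const (isCompact_closedBall _ _).measure_lt_top.ne)
  have hb : ∀ (k : ℕ), ∀ t ∈ Icc (-1) T, ∀ x : Euc 2, ‖cutoff (k + 1) (t, x) * f (t, x)‖
      ≤ (Metric.closedBall (0 : Euc 2) 1).indicator (fun _ => M) x := by
    intro k t ht x
    by_cases hx : x ∈ Metric.closedBall (0 : Euc 2) 1
    · rw [indicator_of_mem hx, norm_mul, Real.norm_of_nonneg cutoff_nonneg]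
      exact (mul_le_of_le_one_left (norm_nonneg _) cutoff_le_one).trans (hM t ht x hx)
    · rw [indicator_of_notMem hx, cutoff_mul_eq_zero (hk k) (t, x) ⟨hsub t ht, mem_univ _⟩
        (by simpa using hx), norm_zero]
  refine intervalIntegral.tendsto_integral_filter_of_dominated_convergence
    (fun _ => ∫ x : Euc 2, (Metric.closedBall (0 : Euc 2) 1).indicator (fun _ => M) x) ?_ ?_
    intervalIntegrable_const ?_
  · refine Eventually.of_forall fun k => ?_
    rw [uIoc_of_le hT.1.le]
    exact ((continuousOn_integral_slice (continuousOn_cutoff_mul hf) (cutoff_mul_eq_zero (hk k))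
      hT.2).mono Ioc_subset_Icc_self).aestronglyMeasurable measurableSet_Ioc
  · refine Eventually.of_forall fun k => Eventually.of_forall fun t ht => ?_
    exact norm_integral_le_of_norm_le hbi (Eventually.of_forall (hb k t (hι t ht)))
  · refine Eventually.of_forall fun t ht => ?_
    have ht' := hsub t (hι t ht)
    rw [← integral_indicator measurableSet_ball]
    refine tendsto_integral_of_dominated_convergence _ (fun k => ?_) hbi
      (fun k => Eventually.of_forall (hb k t (hι t ht))) (Eventually.of_forall fun x => ?_)
    · exact (continuousOn_slab_slice (continuousOn_cutoff_mul hf) ht').aestronglyMeasurable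
    · have := (tendsto_cutoff (t, x)).mul_const (f (t, x))
      convert this using 2
      by_cases hx : ‖x‖ < |t|
      · rw [indicator_of_mem (by simpa using hx), indicator_of_mem (by simpa using hx), one_mul]
      · rw [indicator_of_notMem (by simpa using hx), indicator_of_notMem (by simpa using hx),
          zero_mul]

/-- The bound with the cutoff does not depend on `n`, so it survives the limit. -/
lemma integral_cone_scalingDensity_le (hψ : SatisfiesGaugeIdentities ψ D) {δ T : ℝ}
    (hδ : 0 < δ) (hδ' : δ ≤ 1) (hT : T ∈ Ioo (-1 : ℝ) 0) :
    ∫ t in (-1 : ℝ)..T, ∫ x in Metric.ball (0 : Euc 2) |t|, scalingDensity ψ (t, x)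
      ≤ 16 * coneEnergy ψ * (2 / δ + δ * |Real.log (|T|)|) :=
  le_of_tendsto' (tendsto_integral_cutoff (continuousOn_scalingDensity hψ.contDiffOn) hT)
    fun k => integral_cutoff_scalingDensity_le hψ hδ hδ' (by positivity) hT

/-- The truncated cone lies in the compact cylinder `[-1, T] × {|x| ≤ 1}`, on which the integrand is
continuous because `T < 0`. -/
lemma integrableOn_scaling (hψ : ∀ α, ContDiffOn ℝ ∞ (ψ α) slab) {T : ℝ}
    (hT : T ∈ Ioo (-1 : ℝ) 0) :
    IntegrableOn (fun p : Spacetime => ‖(1 / p.1) • scalingComponent ψ p‖ ^ 2 / p.1)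
      {p : Spacetime | p.1 ∈ Icc (-1 : ℝ) T ∧ ‖p.2‖ < |p.1|} := by
  have h1 : ContinuousOn (fun p : Spacetime => ‖(1 / p.1) • scalingComponent ψ p‖ ^ 2 / p.1) slab := by
    refine (continuousOn_scalingDensity hψ).neg.congr fun p _ => ?_
    simp [scalingDensity, div_neg]
  have h2 : Icc (-1) T ×ˢ Metric.closedBall (0 : Euc 2) 1 ⊆ slab := fun p hp =>
    ⟨⟨hp.1.1, hp.1.2.trans_lt hT.2⟩, mem_univ _⟩
  refine ((h1.mono h2).integrableOn_compact
    (isCompact_Icc.prod (isCompact_closedBall _ _))).mono_set fun p hp => ⟨hp.1, ?_⟩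
  have h3 : |p.1| ≤ 1 := abs_le.2 ⟨hp.1.1, by linarith [hp.1.2, hT.2]⟩
  simpa using (hp.2.trans_le h3).le

lemma tendsto_scaling_average (hψ : SatisfiesGaugeIdentities ψ D) :
    Tendsto (fun T : ℝ => (1 / |Real.log (|T|)|) * ∫ t in (-1 : ℝ)..T,
      (∫ x in Metric.ball (0 : Euc 2) |t|, ‖(1 / t) • scalingComponent ψ (t, x)‖ ^ 2) / t)
      (𝓝[<] 0) (𝓝 0) := by
  have hΛ : Tendsto (fun T : ℝ => |Real.log (|T|)|) (𝓝[<] 0) atTop := by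
    have h1 : Tendsto (fun T : ℝ => Real.log |T|) (𝓝[<] 0) atBot := by
      simp only [Real.log_abs]
      exact Real.tendsto_log_nhdsLT_zero
    exact tendsto_abs_atBot_atTop.comp h1
  have hbound : Tendsto (fun T : ℝ => 48 * coneEnergy ψ * (√|Real.log (|T|)|)⁻¹) (𝓝[<] 0) (𝓝 0) := by
    simpa using ((tendsto_inv_atTop_zero.comp
      (Real.tendsto_sqrt_atTop.comp hΛ)).const_mul (48 * coneEnergy ψ))
  refine squeeze_zero_norm' ?_ hbound
  -- `Λ ≥ 1` ensures that `δ = Λ^{-1/2}` is at most 1.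
  filter_upwards [hΛ.eventually_ge_atTop 1, Ioo_mem_nhdsLT (show (-1 : ℝ) < 0 by norm_num)]
    with T hL hT
  set Λ := |Real.log (|T|)| with hΛdef
  have hneg : (∫ t in (-1 : ℝ)..T,
      (∫ x in Metric.ball (0 : Euc 2) |t|, ‖(1 / t) • scalingComponent ψ (t, x)‖ ^ 2) / t)
      = -∫ t in (-1 : ℝ)..T, ∫ x in Metric.ball (0 : Euc 2) |t|, scalingDensity ψ (t, x) := by
    rw [← intervalIntegral.integral_neg]
    congr 1
    funext t
    simp only [scalingDensity, integral_div, div_neg, integral_neg, neg_neg]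
  have hnn : 0 ≤ ∫ t in (-1 : ℝ)..T, ∫ x in Metric.ball (0 : Euc 2) |t|,
      scalingDensity ψ (t, x) := by
    refine intervalIntegral.integral_nonneg hT.1.le fun t ht => integral_nonneg fun x => ?_
    exact div_nonneg (sq_nonneg _) (by simpa using (ht.2.trans hT.2.le))
  have hs1 : 1 ≤ √Λ := Real.one_le_sqrt.2 hL
  have hs0 : 0 < √Λ := by linarith
  have hsq : √Λ * √Λ = Λ := Real.mul_self_sqrt (by linarith)
  -- This `δ` balances the two terms: `2/δ + δ Λ = 3 √Λ`, whence the constant `48 = 16 · 3`.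
  have hle := integral_cone_scalingDensity_le hψ (δ := (√Λ)⁻¹) (inv_pos.2 hs0)
    (inv_le_one_of_one_le₀ hs1) hT
  rw [← hΛdef] at hle
  rw [hneg, norm_mul, norm_neg, Real.norm_of_nonneg hnn, Real.norm_of_nonneg (by positivity)]
  refine (mul_le_mul_of_nonneg_left hle (by positivity)).trans (le_of_eq ?_)
  generalize √Λ = s at hs0 hsq
  rw [← hsq]
  field_simp
  ring

end

end WaveMap

end

theorem proposition3p1 {m : ℕ} {N : Type*} [TopologicalSpace N]
    [ChartedSpace (WaveMap.Euc m) N] [IsManifold (𝓡 m) ∞ N] (h : WaveMap.RiemMetric m N)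
    (ψ : Fin 3 → WaveMap.Spacetime → WaveMap.Euc m)
    (hψ : WaveMap.IsSchwartzDerivativeWaveMap h ψ) :
    (∀ T ∈ Ioo (-1 : ℝ) 0,
      IntegrableOn
        (fun p : WaveMap.Spacetime => ‖(1 / p.1) • WaveMap.scalingComponent ψ p‖ ^ 2 / p.1)
        {p : WaveMap.Spacetime | p.1 ∈ Icc (-1 : ℝ) T ∧ ‖p.2‖ < |p.1|}) ∧
    Tendsto
      (fun T : ℝ => (1 / |Real.log (|T|)|) *
        ∫ t in (-1 : ℝ)..T,
          (∫ x in Metric.ball (0 : WaveMap.Euc 2) |t|,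
            ‖(1 / t) • WaveMap.scalingComponent ψ (t, x)‖ ^ 2) / t)
      (𝓝[<] 0) (𝓝 0) := by
  obtain ⟨D, hD⟩ := hψ.exists_gaugeIdentities
  exact ⟨fun T hT => WaveMap.integrableOn_scaling hD.contDiffOn hT,
    WaveMap.tendsto_scaling_average hD⟩
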